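/- Let $m,u\ge 1$, $n=m+u$, let $z_1,\dots,z_n$ be the points of a full sample, and let $\mathcal H$ be a class of real-valued functions, with $h(i):=h(z_i)$ and $|h(i)|\le H_0$ for all $h\in\mathcal H$, $i\in[n]$. Let $A\subseteq[n]$ (the test indices) be drawn uniformly at random among all subsets of size $u$; the training indices are $\bar A=[n]\setminus A$. Put $$\mathcal U_h(A)=\frac1u\sum_{i\in A}h(i),\qquad \mathcal L_h(\bar A)=\frac1m\sum_{i\in\bar A}h(i),\qquad \mathcal L_n(h)=\frac1n\sum_{i=1}^n h(i),\qquad T_n(h)=\frac1n\sum_{i=1}^n h(i)^2,$$ $R^+_{u}h=\mathcal U_h(A)-\mathcal L_n(h)$, $R^+_{m}h=\mathcal L_h(\bar A)-\mathcal L_n(h)$ and $R^-_{m}h=-R^+_{m}h$. A function $\psi:[0,\infty)\to[0,\infty)$ is called sub-root if it is nondecreasing and $\psi(r)/\sqrt r$ is nonincreasing for $r>0$; its fixed point is the positive solution of $\psi(r)=r$, which is unique (and it is $0$ if $\psi\equiv0$). Let $K>1$. There are a constant $c_0>0$ depending only on $K$, and, for every $H_0>0$, a constant $c_1>0$ depending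 only on $K$ and $H_0$, such that the following holds for all $m,u$, all samples and all classes $\mathcal H$ as above. Let $\tilde T_n:\mathcal H\to[0,\infty)$ satisfy $T_n(h)\le\tilde T_n(h)$ for all $h\in\mathcal H$. Let $\psi_u,\psi_m$ be sub-root functions with fixed points $r_u,r_m$, such that (a supremum over the empty set being $0$) $$\psi_u(r)\ \ge\ \max\Big\{\mathbb E\sup_{h\in\mathcal H,\ \tilde T_n(h)\le r}R^+_{u}h,\ \ \mathbb E\sup_{h\in\mathcal H,\ \tilde T_n(h)\le r}R^+_{u}h^2\Big\}\quad\text{for all } r\ge r_u,$$ $$\psi_m(r)\ \ge\ \max\Big\{\mathbb E\sup_{h\in\mathcal H,\ \tilde T_n(h)\le r}R^-_{m}h,\ \ \mathbb E\sup_{h\in\mathcal H,\ \tilde T_n(h)\le r}R^+_{m}h^2\Big\}\quad\text{for all } r\ge r_m.$$ Then for every $x\ge 1$, and even for every $x>0$ if $\mathcal H$ contains a function $h_0$ that vanishes on the sample and has $\tilde T_n(h_0)\le\max\{r_u,r_m\}$, with probability at least $1-e^{-x}$, $$\mathcal U_h(A)\ \le\ \mathcal L_h(\bar A)+\frac{\tilde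 T_n(h)}{K}+c_0\,(r_u+r_m)+\frac{c_1\,x}{\min\{m,u\}}\qquad\text{for all } h\in\mathcal H .$$ -/

import Mathlib

open scoped BigOperators

noncomputable section

namespace TLC

/-- Average of `g` over a finite set `A` of indices. With `A` the test set this is the test loss
`U_h^{(u)}`, with `A` the training set it is the training loss `L_h^{(m)}`. -/
def avg {n : ℕ} (A : Finset (Fin n)) (g : Fin n → ℝ) : ℝ :=
  (∑ i ∈ A, g i) / (A.card : ℝ)

/-- The average `L_n(g)` over the full sample. -/
def fullAvg {n : ℕ} (g : Fin n → ℝ) : ℝ :=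
  (∑ i, g i) / (n : ℝ)

/-- The values `h(i) = h(z_i)` of a function on the full sample `z_1, …, z_n`. -/
def onSample {n : ℕ} {Z : Type*} (z : Fin n → Z) (h : Z → ℝ) : Fin n → ℝ :=
  fun i => h (z i)

/-- The values `h²(i)` of the square of a function on the full sample. -/
def onSampleSq {n : ℕ} {Z : Type*} (z : Fin n → Z) (h : Z → ℝ) : Fin n → ℝ :=
  fun i => h (z i) ^ 2

/-- The average squared loss `T_n(h)`. -/
def Tn {n : ℕ} {Z : Type*} (z : Fin n → Z) (h : Z → ℝ) : ℝ :=
  fullAvg (onSampleSq z h)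

/-- The possible test index sets: all subsets of size `u` of the `m + u` indices. -/
def testSets (m u : ℕ) : Finset (Finset (Fin (m + u))) :=
  Finset.powersetCard u Finset.univ

/-- Expectation over a test index set drawn uniformly at random among all subsets of size `u`
(sampling without replacement). -/
def expect (m u : ℕ) (F : Finset (Fin (m + u)) → ℝ) : ℝ :=
  (∑ A ∈ testSets m u, F A) / ((testSets m u).card : ℝ)

open Classical in
/-- Probability of an event under the same uniform sampling without replacement. -/
def prob (m u : ℕ) (E : Finset (Fin (m + u)) → Prop) : ℝ :=
  (((testSets m u).filter E).card : ℝ) / ((testSets m u).card : ℝ)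

/-- `R⁺_u g`, as a function of the test index set `A`. -/
def RuPlus {n : ℕ} (A : Finset (Fin n)) (g : Fin n → ℝ) : ℝ :=
  avg A g - fullAvg g

/-- `R⁺_m g`, as a function of the test index set `A`; the training index set is `Aᶜ`. -/
def RmPlus {n : ℕ} (A : Finset (Fin n)) (g : Fin n → ℝ) : ℝ :=
  avg Aᶜ g - fullAvg g

/-- `R⁻_m g = -R⁺_m g`. -/
def RmMinus {n : ℕ} (A : Finset (Fin n)) (g : Fin n → ℝ) : ℝ :=
  -RmPlus A g

/-- The localized class `{h ∈ H : T(h) ≤ r}`. -/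
def localized {Z : Type*} (H : Set (Z → ℝ)) (T : (Z → ℝ) → ℝ) (r : ℝ) : Set (Z → ℝ) :=
  {h | h ∈ H ∧ T h ≤ r}

/-- Sub-root functions on `[0, ∞)`. -/
structure IsSubRoot (ψ : ℝ → ℝ) : Prop where
  nonneg : ∀ r, 0 ≤ r → 0 ≤ ψ r
  mono : MonotoneOn ψ (Set.Ici 0)
  anti : AntitoneOn (fun r => ψ r / Real.sqrt r) (Set.Ioi 0)

/-- `r` is the fixed point of the sub-root function `ψ`. A sub-root function that is not
identically zero has exactly one positive fixed point, possibly besides the trivial one `0`,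
and the positive one is meant; the zero function has only the fixed point `0`. Both cases are
covered by taking the greatest fixed point. -/
def IsFixedPointOf (ψ : ℝ → ℝ) (r : ℝ) : Prop :=
  IsGreatest {s : ℝ | 0 ≤ s ∧ ψ s = s} r

end TLC

end

open scoped BigOperators

/-! The smaller of the two samples, of size `k`, deviates from the full average by at least half the
gap between test and training loss. So a one-sided bound for that sample suffices, and only its own
sub-root function is used; for the training sample it is applied to `-h`.

The concentration comes from convexity. On the discrete cube, a maximum of affine functions obeys an
exponential inequality of infimum-convolution type (`cube_exp_mul_exp_le`), with penalty half the
squared slope. Two `k`-sets `A`, `B` carry such a cube: matched elements of `A \ B` and `B \ A` may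
be swapped independently, and the uniform law on pairs is invariant under these swaps. Averaging
over permutations and then applying Jensen in `B` gives an exponential inequality for suprema under
sampling without replacement, penalized by `∑ q²` (`sliceMean_exp_iSup_le`). Taking `q` to be a
multiple of `l h + 4 l² h²` makes the added square pay for the random part of the penalty; this is
why the expected suprema of both `h` and `h²` enter.

Localization is by peeling. Functions with `T h` about `4 ^ p * r` get weight `4 ^ (-p)`, while the
sub-root property lets the expected supremum grow only like `2 ^ p`, so the weighted shells sum
geometrically (`sliceMean_iSup_weighted_le`). Undoing the weights costs a factor linear in `T h /
r`, which becomes the term `T h / K`. -/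

/-! ### Convex concentration on the discrete cube. -/

theorem exp_mul_two_sub_le {θ : ℝ} (h0 : 0 ≤ θ) (h1 : θ ≤ 1) :
    Real.exp θ * (2 - θ) ≤ 2 + θ := by
  have h := Real.exp_bound' h0 h1 (n := 3) (by norm_num)
  simp [Finset.sum_range_succ, Nat.factorial] at h
  have : Real.exp θ * (2 - θ) ≤ (1 + θ + θ ^ 2 / 2 + θ ^ 3 * (3 + 1) / (3 * 2 * 3)) * (2 - θ) := by
    refine mul_le_mul_of_nonneg_right ?_ (by linarith)
    linarith
  refine this.trans ?_
  nlinarith [pow_nonneg h0 3, pow_nonneg h0 4]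

/-- This is `d ≤ sinh d` multiplied by `exp (-d)`. -/
theorem mul_exp_neg_le {d : ℝ} (hd : 0 ≤ d) :
    d * Real.exp (-d) ≤ (1 - Real.exp (-d) ^ 2) / 2 := by
  have h := Real.self_le_sinh_iff.2 hd
  rw [Real.sinh_eq] at h
  have hp := Real.exp_pos (-d)
  have he : Real.exp d * Real.exp (-d) = 1 := by rw [← Real.exp_add]; simp
  nlinarith

/-- The two-point inequality behind the induction for convex functions on the cube. -/
theorem two_point {d : ℝ} (hd : 0 ≤ d) :
    ∃ θ : ℝ, 0 ≤ θ ∧ θ ≤ 1 ∧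
      (1 + Real.exp (θ ^ 2 / 2 + (1 - θ) * d)) * (1 + Real.exp (-d)) ≤ 4 := by
  have hp := Real.exp_pos (-d)
  have h1 : Real.exp (-d) ≤ 1 := Real.exp_le_one_iff.2 (by linarith)
  -- With this `θ`, `mul_exp_neg_le` says exactly that the exponent is at most `θ`, and the claim
  -- becomes `(1 + exp θ) * (2 - θ) ≤ 4`.
  refine ⟨1 - Real.exp (-d), by linarith, by linarith, ?_⟩
  set θ := 1 - Real.exp (-d) with hθ
  have he : Real.exp (-d) = 1 - θ := by rw [hθ]; ring
  have hm := mul_exp_neg_le hd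
  rw [he] at hm ⊢
  have h2 : Real.exp (θ ^ 2 / 2 + (1 - θ) * d) ≤ Real.exp θ :=
    Real.exp_le_exp.2 (by nlinarith)
  have h3 := exp_mul_two_sub_le (θ := θ) (by rw [hθ]; linarith) (by rw [hθ]; linarith)
  nlinarith

/-- Hölder's inequality in logarithmic form, proved by convexity of `exp` after normalizing both
sums by their bounds. -/
theorem sum_exp_interpolate {β : Type*} (s : Finset β) (G₀ G₁ : β → ℝ) {ℓ₀ ℓ₁ θ : ℝ}
    (h₀ : ∑ t ∈ s, Real.exp (G₀ t) ≤ Real.exp ℓ₀) (h₁ : ∑ t ∈ s, Real.exp (G₁ t) ≤ Real.exp ℓ₁)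
    (hθ₀ : 0 ≤ θ) (hθ₁ : θ ≤ 1) :
    ∑ t ∈ s, Real.exp ((1 - θ) * G₀ t + θ * G₁ t) ≤ Real.exp ((1 - θ) * ℓ₀ + θ * ℓ₁) := by
  have key : ∀ t, Real.exp ((1 - θ) * G₀ t + θ * G₁ t) ≤ Real.exp ((1 - θ) * ℓ₀ + θ * ℓ₁) *
      ((1 - θ) * (Real.exp (G₀ t) * Real.exp (-ℓ₀)) + θ * (Real.exp (G₁ t) * Real.exp (-ℓ₁))) := by
    intro t
    have hc := convexOn_exp.2 (Set.mem_univ (G₀ t - ℓ₀)) (Set.mem_univ (G₁ t - ℓ₁))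
      (sub_nonneg.2 hθ₁) hθ₀ (by ring)
    simp only [smul_eq_mul] at hc
    rw [← Real.exp_add, ← Real.exp_add]
    calc _ = Real.exp ((1 - θ) * ℓ₀ + θ * ℓ₁) *
          Real.exp ((1 - θ) * (G₀ t - ℓ₀) + θ * (G₁ t - ℓ₁)) := by
          rw [← Real.exp_add]; congr 1; ring
      _ ≤ _ := mul_le_mul_of_nonneg_left hc (Real.exp_nonneg _)
  refine (Finset.sum_le_sum fun t _ => key t).trans ?_
  rw [← Finset.mul_sum, Finset.sum_add_distrib, ← Finset.mul_sum, ← Finset.mul_sum,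
    ← Finset.sum_mul, ← Finset.sum_mul]
  refine mul_le_of_le_one_right (Real.exp_nonneg _) ?_
  have a₀ : (∑ t ∈ s, Real.exp (G₀ t)) * Real.exp (-ℓ₀) ≤ 1 := by
    rw [Real.exp_neg, ← div_eq_mul_inv]; exact (div_le_one (Real.exp_pos _)).2 h₀
  have a₁ : (∑ t ∈ s, Real.exp (G₁ t)) * Real.exp (-ℓ₁) ≤ 1 := by
    rw [Real.exp_neg, ← div_eq_mul_inv]; exact (div_le_one (Real.exp_pos _)).2 h₁
  nlinarith [sub_nonneg.2 hθ₁]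

/-- Factoring out `exp ℓ₁` leaves `two_point` with `d = ℓ₀ - ℓ₁`. Only the face with the larger
bound needs interpolation. -/
theorem two_point_step {X₀ X₁ N ℓ₀ ℓ₁ : ℝ} (hN : 0 ≤ N) (hl : ℓ₁ ≤ ℓ₀)
    (h₀ : ∀ θ : ℝ, 0 ≤ θ → θ ≤ 1 → X₀ ≤ Real.exp (θ ^ 2 / 2 + ((1 - θ) * ℓ₀ + θ * ℓ₁)))
    (h₁ : X₁ ≤ Real.exp ℓ₁) :
    (X₀ + X₁) * (N * Real.exp (-ℓ₀) + N * Real.exp (-ℓ₁)) ≤ 4 * N := by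
  obtain ⟨θ, hθ₀, hθ₁, hθ⟩ := two_point (sub_nonneg.2 hl)
  have e₀ : Real.exp (θ ^ 2 / 2 + ((1 - θ) * ℓ₀ + θ * ℓ₁)) =
      Real.exp ℓ₁ * Real.exp (θ ^ 2 / 2 + (1 - θ) * (ℓ₀ - ℓ₁)) := by
    rw [← Real.exp_add]; congr 1; ring
  have e₁ : Real.exp (-ℓ₀) = Real.exp (-ℓ₁) * Real.exp (-(ℓ₀ - ℓ₁)) := by
    rw [← Real.exp_add]; congr 1; ring
  have e₂ : Real.exp ℓ₁ * Real.exp (-ℓ₁) = 1 := by rw [← Real.exp_add]; simp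
  have hX := h₀ θ hθ₀ hθ₁
  rw [e₀] at hX
  rw [e₁]
  set E := Real.exp (θ ^ 2 / 2 + (1 - θ) * (ℓ₀ - ℓ₁))
  set D := Real.exp (-(ℓ₀ - ℓ₁))
  have hD : 0 ≤ D := Real.exp_nonneg _
  calc (X₀ + X₁) * (N * (Real.exp (-ℓ₁) * D) + N * Real.exp (-ℓ₁))
      ≤ (Real.exp ℓ₁ * E + Real.exp ℓ₁) * (N * (Real.exp (-ℓ₁) * D) + N * Real.exp (-ℓ₁)) := by
        refine mul_le_mul_of_nonneg_right (by linarith) (by positivity)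
    _ = (Real.exp ℓ₁ * Real.exp (-ℓ₁)) * N * ((1 + E) * (1 + D)) := by ring
    _ ≤ 4 * N := by rw [e₂]; nlinarith

/-- Concentration of convex functions on the cube, in infimum-convolution form, for a maximum of
finitely many affine functions. -/
theorem cube_exp_mul_exp_le {ι κ : Type*} [Finite ι] [Nonempty ι] [DecidableEq κ]
    (s : Finset κ) (b : ι → κ → ℝ) :
    ∀ a : ι → ℝ,
    (∑ t ∈ s.powerset, Real.exp (⨆ j, (a j + ∑ i ∈ t, b j i - (∑ i ∈ s, b j i ^ 2) / 2))) *
      (∑ t ∈ s.powerset, Real.exp (-⨆ j, (a j + ∑ i ∈ t, b j i))) ≤ 4 ^ s.card := by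
  have bdd : ∀ f : ι → ℝ, BddAbove (Set.range f) := fun f => (Set.finite_range f).bddAbove
  induction s using Finset.induction_on with
  | empty => intro a; simp [← Real.exp_add]
  | insert i s his ih =>
    intro a
    rw [Finset.sum_powerset_insert his, Finset.sum_powerset_insert his,
      Finset.card_insert_of_notMem his, pow_succ']
    have hmem : ∀ t ∈ s.powerset, i ∉ t := fun t ht h => his (Finset.mem_powerset.1 ht h)
    set a' : ι → ℝ := fun j => a j + b j i with ha'
    have I₀ := ih a
    have I₁ := ih a'
    set G₀ : Finset κ → ℝ := fun t => ⨆ j, (a j + ∑ i ∈ t, b j i - (∑ i ∈ s, b j i ^ 2) / 2)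
    set G₁ : Finset κ → ℝ := fun t => ⨆ j, (a' j + ∑ i ∈ t, b j i - (∑ i ∈ s, b j i ^ 2) / 2)
    set p₀ := ∑ t ∈ s.powerset, Real.exp (-⨆ j, (a j + ∑ i ∈ t, b j i)) with hp₀
    set p₁ := ∑ t ∈ s.powerset, Real.exp (-⨆ j, (a' j + ∑ i ∈ t, b j i)) with hp₁
    have P₀ : 0 < p₀ := Finset.sum_pos (fun _ _ => Real.exp_pos _) ⟨∅, by simp⟩
    have P₁ : 0 < p₁ := Finset.sum_pos (fun _ _ => Real.exp_pos _) ⟨∅, by simp⟩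
    have hq : ∑ t ∈ s.powerset, Real.exp (-⨆ j, (a j + ∑ k ∈ insert i t, b j k)) = p₁ := by
      refine Finset.sum_congr rfl fun t ht => ?_
      simp only [Finset.sum_insert (hmem t ht), ha', add_assoc]
    rw [hq]
    set N : ℝ := 4 ^ s.card
    have hN : 0 < N := by positivity
    -- The induction hypotheses on the two faces of the new coordinate are rewritten as bounds `exp
    -- ℓ₀`, `exp ℓ₁` on their exponential sums.
    set ℓ₀ := Real.log (N / p₀) with hℓ₀
    set ℓ₁ := Real.log (N / p₁) with hℓ₁
    have E₀ : Real.exp ℓ₀ = N / p₀ := Real.exp_log (by positivity)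
    have E₁ : Real.exp ℓ₁ = N / p₁ := Real.exp_log (by positivity)
    have N₀ : p₀ = N * Real.exp (-ℓ₀) := by rw [Real.exp_neg, E₀]; field_simp
    have N₁ : p₁ = N * Real.exp (-ℓ₁) := by rw [Real.exp_neg, E₁]; field_simp
    have J₀ : ∑ t ∈ s.powerset, Real.exp (G₀ t) ≤ Real.exp ℓ₀ := by
      rw [E₀, le_div_iff₀ P₀]; exact I₀
    have J₁ : ∑ t ∈ s.powerset, Real.exp (G₁ t) ≤ Real.exp ℓ₁ := by
      rw [E₁, le_div_iff₀ P₁]; exact I₁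
    have X₀ : ∀ θ : ℝ, 0 ≤ θ → θ ≤ 1 → ∑ t ∈ s.powerset,
        Real.exp (⨆ j, (a j + ∑ k ∈ t, b j k - (∑ k ∈ insert i s, b j k ^ 2) / 2)) ≤
        Real.exp (θ ^ 2 / 2 + ((1 - θ) * ℓ₀ + θ * ℓ₁)) := by
      intro θ h0 h1
      rw [Real.exp_add]
      refine le_trans ?_ (mul_le_mul_of_nonneg_left
        (sum_exp_interpolate s.powerset G₀ G₁ J₀ J₁ h0 h1) (Real.exp_nonneg _))
      rw [Finset.mul_sum]
      refine Finset.sum_le_sum fun t ht => ?_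
      rw [← Real.exp_add]
      refine Real.exp_le_exp.2 (ciSup_le fun j => ?_)
      have g0 := mul_le_mul_of_nonneg_left (le_ciSup (bdd fun j => (a j + ∑ i ∈ t, b j i -
        (∑ i ∈ s, b j i ^ 2) / 2)) j) (sub_nonneg.2 h1)
      have g1 := mul_le_mul_of_nonneg_left (le_ciSup (bdd fun j => (a' j + ∑ i ∈ t, b j i -
        (∑ i ∈ s, b j i ^ 2) / 2)) j) h0
      rw [Finset.sum_insert his]
      simp only [ha'] at g1
      change _ ≤ (1 - θ) * G₀ t at g0
      change _ ≤ θ * G₁ t at g1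
      -- Moving a fraction `θ` towards the other face changes the affine part by `θ * b j i`, which
      -- the new penalty and `θ ^ 2 / 2` absorb by completing the square.
      nlinarith [sq_nonneg (θ + b j i)]
    have X₁ : ∀ θ : ℝ, 0 ≤ θ → θ ≤ 1 → ∑ t ∈ s.powerset,
        Real.exp (⨆ j, (a j + ∑ k ∈ insert i t, b j k - (∑ k ∈ insert i s, b j k ^ 2) / 2)) ≤
        Real.exp (θ ^ 2 / 2 + ((1 - θ) * ℓ₁ + θ * ℓ₀)) := by
      intro θ h0 h1
      rw [Real.exp_add]
      refine le_trans ?_ (mul_le_mul_of_nonneg_left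
        (sum_exp_interpolate s.powerset G₁ G₀ J₁ J₀ h0 h1) (Real.exp_nonneg _))
      rw [Finset.mul_sum]
      refine Finset.sum_le_sum fun t ht => ?_
      rw [← Real.exp_add]
      refine Real.exp_le_exp.2 (ciSup_le fun j => ?_)
      have g0 := mul_le_mul_of_nonneg_left (le_ciSup (bdd fun j => (a j + ∑ i ∈ t, b j i -
        (∑ i ∈ s, b j i ^ 2) / 2)) j) h0
      have g1 := mul_le_mul_of_nonneg_left (le_ciSup (bdd fun j => (a' j + ∑ i ∈ t, b j i -
        (∑ i ∈ s, b j i ^ 2) / 2)) j) (sub_nonneg.2 h1)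
      rw [Finset.sum_insert his, Finset.sum_insert (hmem t ht)]
      simp only [ha'] at g1
      change _ ≤ θ * G₀ t at g0
      change _ ≤ (1 - θ) * G₁ t at g1
      nlinarith [sq_nonneg (θ - b j i)]
    rw [N₀, N₁]
    rcases le_total ℓ₁ ℓ₀ with h | h
    · exact two_point_step hN.le h X₀ (by simpa using X₁ 0 le_rfl zero_le_one)
    · have := two_point_step hN.le h X₁ (by simpa using X₀ 0 le_rfl zero_le_one)
      linarith

/-! ### Random swaps between two sets of equal size. -/

/-- Two finite sets of equal size are matched off their intersection by an involution. -/
theorem exists_involution_sdiff {α : Type*} [DecidableEq α] {A B : Finset α}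
    (h : A.card = B.card) :
    ∃ f : α → α, Function.Involutive f ∧ (∀ x ∈ A \ B, f x ∈ B \ A) ∧
      (∀ x ∈ B \ A, f x ∈ A \ B) ∧ ∀ x ∈ A ∩ B, f x = x := by
  have hc : (A \ B).card = (B \ A).card := by
    have h₁ := Finset.card_sdiff_add_card_inter A B
    have h₂ := Finset.card_sdiff_add_card_inter B A
    rw [Finset.inter_comm B A] at h₂
    omega
  let e : (A \ B : Finset α) ≃ (B \ A : Finset α) := Finset.equivOfCardEq hc
  have hdisj : ∀ x, x ∈ A \ B → x ∈ B \ A → False := by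
    intro x hx hy
    simp only [Finset.mem_sdiff] at hx hy
    exact hy.2 hx.1
  let f : α → α := fun x => if hx : x ∈ A \ B then e ⟨x, hx⟩
    else if hy : x ∈ B \ A then e.symm ⟨x, hy⟩ else x
  have f₁ : ∀ x (hx : x ∈ A \ B), f x = e ⟨x, hx⟩ := fun x hx => dif_pos hx
  have f₂ : ∀ x (hy : x ∈ B \ A), f x = e.symm ⟨x, hy⟩ := fun x hy => by
    have hx : x ∉ A \ B := fun hx => hdisj x hx hy
    exact (dif_neg hx).trans (dif_pos hy)
  have f₃ : ∀ x, x ∉ A \ B → x ∉ B \ A → f x = x := fun x hx hy =>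
    (dif_neg hx).trans (dif_neg hy)
  refine ⟨f, fun x => ?_, fun x hx => ?_, fun x hx => ?_, fun x hx => ?_⟩
  · by_cases hx : x ∈ A \ B
    · rw [f₁ x hx, f₂ _ (e ⟨x, hx⟩).2]; simp
    · by_cases hy : x ∈ B \ A
      · rw [f₂ x hy, f₁ _ (e.symm ⟨x, hy⟩).2]; simp
      · rw [f₃ x hx hy, f₃ x hx hy]
  · rw [f₁ x hx]; exact (e ⟨x, hx⟩).2
  · rw [f₂ x hx]; exact (e.symm ⟨x, hx⟩).2
  · rw [Finset.mem_inter] at hx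
    exact f₃ x (by simp [hx.2]) (by simp [hx.1])

/-- For two sets `A`, `B` of equal size, the matched elements can be swapped independently of each
other by permutations, and this acts on the sums over `A` and over `B` in opposite ways. -/
theorem exists_swaps {α : Type*} [DecidableEq α] {A B : Finset α} (h : A.card = B.card) :
    ∃ (f : α → α) (τ : Finset α → Equiv.Perm α), ∀ g : α → ℝ,
      (∀ t ∈ (A \ B).powerset,
        ∑ x ∈ A, g (τ t x) = ∑ x ∈ A, g x + ∑ x ∈ t, (g (f x) - g x) ∧
        ∑ x ∈ B, g (τ t x) = ∑ x ∈ A, g x + ∑ x ∈ (A \ B) \ t, (g (f x) - g x)) ∧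
      ∑ x ∈ B, g x = ∑ x ∈ A, g x + ∑ x ∈ A \ B, (g (f x) - g x) := by
  obtain ⟨f, hf, hAB, hBA, hI⟩ := exists_involution_sdiff h
  have hτ : ∀ t : Finset α,
      Function.Involutive fun x => if x ∈ t ∨ f x ∈ t then f x else x := by
    intro t x
    by_cases hx : x ∈ t ∨ f x ∈ t
    · have hx' : f x ∈ t ∨ f (f x) ∈ t := by rw [hf x]; exact hx.symm
      simp only [if_pos hx, if_pos hx']
      exact hf x
    · simp only [if_neg hx]
  refine ⟨f, fun t => (hτ t).toPerm _, fun g => ?_⟩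
  have hsplit : ∀ (A B : Finset α) (g : α → ℝ),
      ∑ x ∈ A \ B, g x + ∑ x ∈ A ∩ B, g x = ∑ x ∈ A, g x := fun A B g => by
    rw [add_comm, Finset.sum_inter_add_sum_sdiff]
  have sA : ∑ x ∈ A, g x = ∑ x ∈ A \ B, g x + ∑ x ∈ A ∩ B, g x :=
    (hsplit A B g).symm
  have sB : ∀ g : α → ℝ, ∑ x ∈ B, g x = ∑ x ∈ A \ B, g (f x) + ∑ x ∈ A ∩ B, g x := by
    intro g
    rw [← hsplit B A g, Finset.inter_comm B A]
    congr 1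
    refine Finset.sum_bij' (fun x _ => f x) (fun x _ => f x) hBA hAB (fun x _ => hf x)
      (fun x _ => hf x) fun x _ => by rw [hf x]
  have hite : ∀ t ⊆ A \ B, ∑ x ∈ t, (g (f x) - g x) =
      ∑ x ∈ A \ B, if x ∈ t then g (f x) - g x else 0 := fun t ht => by
    rw [Finset.sum_ite_mem, Finset.inter_eq_right.2 ht]
  refine ⟨fun t ht => ?_, ?_⟩
  · rw [Finset.mem_powerset] at ht
    have htA : ∀ x ∈ t, x ∈ A \ B := fun x hx => ht hx
    have vA : ∀ x ∈ A \ B, (hτ t).toPerm _ x = if x ∈ t then f x else x := by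
      intro x hx
      have : f x ∉ t := fun hy => (Finset.mem_sdiff.1 (htA _ hy)).2 (Finset.mem_sdiff.1 (hAB x hx)).1
      simp [this]
    have vB : ∀ x ∈ A \ B, (hτ t).toPerm _ (f x) = if x ∈ t then x else f x := by
      intro x hx
      have : f x ∉ t := fun hy => (Finset.mem_sdiff.1 (htA _ hy)).2 (Finset.mem_sdiff.1 (hAB x hx)).1
      simp [this, hf x]
    have vI : ∀ x ∈ A ∩ B, (hτ t).toPerm _ x = x := by
      intro x hx
      simp [hI x hx]
    have eI : ∑ x ∈ A ∩ B, g ((hτ t).toPerm _ x) = ∑ x ∈ A ∩ B, g x :=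
      Finset.sum_congr rfl fun x hx => by rw [vI x hx]
    constructor
    · rw [← hsplit A B, eI, sA]
      have : ∑ x ∈ A \ B, g ((hτ t).toPerm _ x) =
          ∑ x ∈ A \ B, g x + ∑ x ∈ t, (g (f x) - g x) := by
        rw [hite t ht, ← Finset.sum_add_distrib]
        refine Finset.sum_congr rfl fun x hx => ?_
        rw [vA x hx]
        split_ifs <;> ring
      rw [this]; ring
    · rw [sB, eI, sA]
      have : ∑ x ∈ A \ B, g ((hτ t).toPerm _ (f x)) =
          ∑ x ∈ A \ B, g x + ∑ x ∈ (A \ B) \ t, (g (f x) - g x) := by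
        rw [hite _ Finset.sdiff_subset, ← Finset.sum_add_distrib]
        refine Finset.sum_congr rfl fun x hx => ?_
        rw [vB x hx]
        by_cases hxt : x ∈ t
        · simp [hxt]
        · simp only [hxt, if_false, Finset.mem_sdiff.2 ⟨hx, hxt⟩, if_true]; ring
      rw [this]; ring
  · rw [Finset.sum_sub_distrib, sA, sB g]
    ring

theorem sum_exp_half_le {β : Type*} (s : Finset β) (F G : β → ℝ) {N : ℝ} (hN : 0 ≤ N)
    (h : (∑ t ∈ s, Real.exp (F t)) * (∑ t ∈ s, Real.exp (G t)) ≤ N ^ 2) :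
    ∑ t ∈ s, Real.exp ((F t + G t) / 2) ≤ N := by
  have hs : ∀ y : ℝ, Real.exp (y / 2) ^ 2 = Real.exp y := fun y => by
    rw [← Real.exp_nat_mul]; congr 1; push_cast; ring
  have := Finset.sum_mul_sq_le_sq_mul_sq s (fun t => Real.exp (F t / 2))
    (fun t => Real.exp (G t / 2))
  simp only [hs, ← Real.exp_add, ← add_div] at this
  exact abs_le_of_sq_le_sq' (this.trans h) hN |>.2

/-- The functional of a pair of index sets that swapping controls. -/
noncomputable def pairGap {ι α : Type*} (a : ι → ℝ) (q : ι → α → ℝ) (A B : Finset α) : ℝ :=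
  (⨆ j, (a j + ∑ x ∈ A, q j x - (∑ x ∈ A, q j x ^ 2 + ∑ x ∈ B, q j x ^ 2))) -
    ⨆ j, (a j + ∑ x ∈ B, q j x)

theorem pairGap_map {ι α : Type*} (a : ι → ℝ) (q : ι → α → ℝ) (A B : Finset α)
    (σ : Equiv.Perm α) :
    pairGap a q (A.map σ.toEmbedding) (B.map σ.toEmbedding) =
      pairGap a (fun j x => q j (σ x)) A B := by
  simp [pairGap, Finset.sum_map]

/-- The subset `t` of swapped elements is a point of a cube on which both suprema are maxima of
affine functions, in opposite directions. Cauchy–Schwarz turns the product bound on the cube into a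
bound on half the gap. -/
theorem sum_exp_pairGap_swaps_le {ι α : Type*} [Finite ι] [Nonempty ι] [DecidableEq α]
    {A B : Finset α} (h : A.card = B.card) :
    ∃ τ : Finset α → Equiv.Perm α, ∀ (a : ι → ℝ) (q : ι → α → ℝ),
      ∑ t ∈ (A \ B).powerset, Real.exp (pairGap a (fun j x => q j (τ t x)) A B / 2) ≤
        2 ^ (A \ B).card := by
  have bdd : ∀ f : ι → ℝ, BddAbove (Set.range f) := fun f => (Set.finite_range f).bddAbove
  obtain ⟨f, τ, hτ⟩ := exists_swaps h
  refine ⟨τ, fun a q => ?_⟩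
  set D := A \ B
  set b : ι → α → ℝ := fun j x => q j (f x) - q j x with hb
  set a' : ι → ℝ := fun j => a j + ∑ x ∈ A, q j x with ha'
  have hcube := cube_exp_mul_exp_le D b a'
  -- Reflecting the cube turns the sum seen from `A` into the sum seen from `B`.
  have hrefl : ∑ t ∈ D.powerset, Real.exp (-⨆ j, (a' j + ∑ i ∈ t, b j i)) =
      ∑ t ∈ D.powerset, Real.exp (-⨆ j, (a' j + ∑ i ∈ D \ t, b j i)) := by
    refine Finset.sum_bij' (fun t _ => D \ t) (fun t _ => D \ t) ?_ ?_ ?_ ?_ ?_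
    · intro t _; simp
    · intro t _; simp
    · intro t ht; simpa using ht
    · intro t ht; simpa using ht
    · intro t ht
      have ht' := Finset.mem_powerset.1 ht
      simp only [Finset.sdiff_sdiff_eq_self ht']
  rw [hrefl] at hcube
  have h4 : (4 : ℝ) ^ D.card = (2 ^ D.card) ^ 2 := by
    rw [← pow_mul, mul_comm, pow_mul]; norm_num
  rw [h4] at hcube
  refine le_trans (Finset.sum_le_sum fun t ht => ?_) (sum_exp_half_le _ _ _ (by positivity) hcube)
  refine Real.exp_le_exp.2 (div_le_div_of_nonneg_right ?_ (by norm_num))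
  unfold pairGap
  rw [sub_eq_add_neg]
  have e₂ : (⨆ j, (a j + ∑ x ∈ B, q j (τ t x))) = ⨆ j, (a' j + ∑ i ∈ D \ t, b j i) := by
    refine iSup_congr fun j => ?_
    rw [((hτ (q j)).1 t ht).2, ha', hb]; simp only; ring
  rw [e₂]
  refine add_le_add_left (ciSup_mono (bdd _) fun j => ?_) _
  have k₁ := ((hτ (q j)).1 t ht).1
  have k₂ := (hτ fun x => q j x ^ 2).1 t ht
  have k₃ := (hτ fun x => q j x ^ 2).2
  have k₄ := Finset.sum_sdiff (Finset.mem_powerset.1 ht)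
    (f := fun x => q j (f x) ^ 2 - q j x ^ 2)
  have k₅ : ∑ x ∈ D, q j x ^ 2 ≤ ∑ x ∈ A, q j x ^ 2 :=
    Finset.sum_le_sum_of_subset_of_nonneg Finset.sdiff_subset fun _ _ _ => sq_nonneg _
  -- The penalty in `pairGap` is unchanged by swaps, and it dominates the cube penalty because `(v -
  -- w)² / 2 ≤ v² + w²`.
  have k₆ : (∑ x ∈ D, b j x ^ 2) / 2 ≤ ∑ x ∈ D, (q j (f x) ^ 2 + q j x ^ 2) := by
    rw [Finset.sum_div]
    refine Finset.sum_le_sum fun x _ => ?_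
    simp only [hb]
    nlinarith [sq_nonneg (q j (f x) + q j x)]
  rw [Finset.sum_add_distrib] at k₆
  simp only [Finset.sum_sub_distrib] at k₂ k₃ k₄
  simp only [ha', hb] at k₆ ⊢
  linarith [k₂.1, k₂.2]

theorem sum_powersetCard_map {α : Type*} [Fintype α] (k : ℕ) (σ : Equiv.Perm α)
    (F : Finset α → ℝ) :
    ∑ A ∈ Finset.powersetCard k Finset.univ, F (A.map σ.toEmbedding) =
      ∑ A ∈ Finset.powersetCard k Finset.univ, F A := by
  refine Finset.sum_bij' (fun A _ => A.map σ.toEmbedding) (fun A _ => A.map σ.symm.toEmbedding)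
    ?_ ?_ ?_ ?_ ?_
  · intro A hA; simpa using hA
  · intro A hA; simpa using hA
  · intro A _; ext x; simp [Finset.mem_map_equiv]
  · intro A _; ext x; simp [Finset.mem_map_equiv]
  · intro A _; rfl

/-- Right multiplication by each swap permutes the group, so the sum may be averaged over all swaps
first; for fixed `σ` the swap bound then applies. -/
theorem sum_perm_exp_pairGap_le {ι α : Type*} [Finite ι] [Nonempty ι] [Fintype α] [DecidableEq α]
    (a : ι → ℝ) (q : ι → α → ℝ) {A B : Finset α} (h : A.card = B.card) :
    ∑ σ : Equiv.Perm α, Real.exp (pairGap a (fun j x => q j (σ x)) A B / 2) ≤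
      (Fintype.card (Equiv.Perm α) : ℝ) := by
  obtain ⟨τ, hτ⟩ := sum_exp_pairGap_swaps_le (ι := ι) h
  have h₁ : ∀ t, ∑ σ : Equiv.Perm α, Real.exp (pairGap a (fun j x => q j (σ x)) A B / 2) =
      ∑ σ : Equiv.Perm α, Real.exp (pairGap a (fun j x => q j (σ (τ t x))) A B / 2) := fun t =>
    (Fintype.sum_equiv (Equiv.mulRight (τ t)) _ _ fun σ => by
      simp [Equiv.Perm.mul_apply]).symm
  have h₂ : ∑ t ∈ (A \ B).powerset, ∑ σ : Equiv.Perm α,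
      Real.exp (pairGap a (fun j x => q j (σ x)) A B / 2) ≤
      ∑ σ : Equiv.Perm α, (2 : ℝ) ^ (A \ B).card := by
    rw [Finset.sum_congr rfl fun t _ => h₁ t, Finset.sum_comm]
    exact Finset.sum_le_sum fun σ _ => hτ a fun j x => q j (σ x)
  simp only [Finset.sum_const, Finset.card_powerset, nsmul_eq_mul, Finset.card_univ] at h₂
  push_cast at h₂
  have h2 : (0 : ℝ) < 2 ^ (A \ B).card := by positivity
  nlinarith

/-- The two-sample exponential inequality for sampling without replacement. -/
theorem sum_sum_exp_pairGap_le {ι α : Type*} [Finite ι] [Nonempty ι] [Fintype α] [DecidableEq α]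
    (k : ℕ) (a : ι → ℝ) (q : ι → α → ℝ) :
    ∑ A ∈ Finset.powersetCard k (Finset.univ : Finset α),
      ∑ B ∈ Finset.powersetCard k (Finset.univ : Finset α), Real.exp (pairGap a q A B / 2) ≤
      ((Finset.powersetCard k (Finset.univ : Finset α)).card : ℝ) ^ 2 := by
  set S := Finset.powersetCard k (Finset.univ : Finset α)
  set X := ∑ A ∈ S, ∑ B ∈ S, Real.exp (pairGap a q A B / 2) with hX
  have h₁ : ∀ σ : Equiv.Perm α,
      X = ∑ A ∈ S, ∑ B ∈ S, Real.exp (pairGap a (fun j x => q j (σ x)) A B / 2) := by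
    intro σ
    rw [hX, ← sum_powersetCard_map k σ]
    refine Finset.sum_congr rfl fun A _ => ?_
    rw [← sum_powersetCard_map k σ]
    refine Finset.sum_congr rfl fun B _ => ?_
    rw [pairGap_map]
  have h₂ : ∑ σ : Equiv.Perm α, X ≤ ∑ A ∈ S, ∑ B ∈ S, (Fintype.card (Equiv.Perm α) : ℝ) := by
    rw [Finset.sum_congr rfl fun σ _ => h₁ σ, Finset.sum_comm]
    refine Finset.sum_le_sum fun A hA => ?_
    rw [Finset.sum_comm]
    refine Finset.sum_le_sum fun B hB => sum_perm_exp_pairGap_le a q ?_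
    rw [(Finset.mem_powersetCard.1 hA).2, (Finset.mem_powersetCard.1 hB).2]
  simp only [Finset.sum_const, nsmul_eq_mul, Finset.card_univ] at h₂
  have h0 : (0 : ℝ) < Fintype.card (Equiv.Perm α) := by exact_mod_cast Fintype.card_pos
  nlinarith

/-! ### Averages and second moments under sampling without replacement. -/

/-- The average over all subsets of size `k`. -/
noncomputable def sliceMean {α : Type*} [Fintype α] (k : ℕ) (F : Finset α → ℝ) : ℝ :=
  (∑ A ∈ Finset.powersetCard k Finset.univ, F A) /
    ((Finset.powersetCard k (Finset.univ : Finset α)).card : ℝ)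

section sliceMean

variable {α : Type*} [Fintype α] {k : ℕ}

theorem card_slice_pos (hk : k ≤ Fintype.card α) :
    (0 : ℝ) < (Finset.powersetCard k (Finset.univ : Finset α)).card := by
  rw [Finset.card_powersetCard, Finset.card_univ]
  exact_mod_cast Nat.choose_pos hk

theorem sliceMean_mono {F G : Finset α → ℝ}
    (h : ∀ A : Finset α, A.card = k → F A ≤ G A) : sliceMean k F ≤ sliceMean k G :=
  div_le_div_of_nonneg_right
    (Finset.sum_le_sum fun A hA => h A (Finset.mem_powersetCard.1 hA).2) (Nat.cast_nonneg _)

theorem sliceMean_add (F G : Finset α → ℝ) :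
    sliceMean k (fun A => F A + G A) = sliceMean k F + sliceMean k G := by
  simp [sliceMean, Finset.sum_add_distrib, add_div]

theorem sliceMean_const_mul (c : ℝ) (F : Finset α → ℝ) :
    sliceMean k (fun A => c * F A) = c * sliceMean k F := by
  simp [sliceMean, ← Finset.mul_sum, mul_div_assoc]

theorem sliceMean_const (hk : k ≤ Fintype.card α) (c : ℝ) :
    sliceMean k (fun _ : Finset α => c) = c := by
  have := card_slice_pos hk
  simp only [sliceMean, Finset.sum_const, nsmul_eq_mul]
  field_simp

theorem sliceMean_sum {κ : Type*} (s : Finset κ) (F : κ → Finset α → ℝ) :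
    sliceMean k (fun A => ∑ i ∈ s, F i A) = ∑ i ∈ s, sliceMean k (F i) := by
  simp only [sliceMean, ← Finset.sum_div]
  rw [Finset.sum_comm]

theorem sliceMean_congr {F G : Finset α → ℝ}
    (h : ∀ A : Finset α, A.card = k → F A = G A) : sliceMean k F = sliceMean k G :=
  le_antisymm (sliceMean_mono fun A hA => (h A hA).le) (sliceMean_mono fun A hA => (h A hA).ge)

theorem sliceMean_map (σ : Equiv.Perm α) (F : Finset α → ℝ) :
    sliceMean k (fun A => F (A.map σ.toEmbedding)) = sliceMean k F := by
  simp only [sliceMean, sum_powersetCard_map]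

theorem exp_sliceMean_le (hk : k ≤ Fintype.card α) (F : Finset α → ℝ) :
    Real.exp (sliceMean k F) ≤ sliceMean k fun A => Real.exp (F A) := by
  have hp := card_slice_pos hk
  have := convexOn_exp.map_sum_le (t := Finset.powersetCard k (Finset.univ : Finset α))
    (w := fun _ => ((Finset.powersetCard k (Finset.univ : Finset α)).card : ℝ)⁻¹) (p := F)
    (fun _ _ => by positivity) 
    (by rw [Finset.sum_const, nsmul_eq_mul]; exact mul_inv_cancel₀ hp.ne')
    (fun _ _ => Set.mem_univ _)
  simp only [smul_eq_mul, ← Finset.mul_sum] at this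
  simpa only [sliceMean, div_eq_inv_mul] using this

theorem sliceMean_abs_le (hk : k ≤ Fintype.card α) {F : Finset α → ℝ} {s : ℝ} (hs : 0 ≤ s)
    (h : sliceMean k (fun A => F A ^ 2) ≤ s ^ 2) : sliceMean k (fun A => |F A|) ≤ s := by
  rcases hs.eq_or_lt with rfl | hs
  · have hp := card_slice_pos hk
    have h0 : ∑ A ∈ Finset.powersetCard k (Finset.univ : Finset α), F A ^ 2 = 0 := by
      refine le_antisymm ?_ (Finset.sum_nonneg fun _ _ => sq_nonneg _)
      rwa [sliceMean, div_le_iff₀ hp, zero_pow two_ne_zero, zero_mul] at h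
    rw [Finset.sum_eq_zero_iff_of_nonneg fun _ _ => sq_nonneg _] at h0
    refine (div_nonpos_of_nonpos_of_nonneg (le_of_eq (Finset.sum_eq_zero fun A hA => ?_)) hp.le)
    simpa using h0 A hA
  · have h₁ : sliceMean k (fun A => |F A|) ≤ sliceMean k fun A => (1 / (2 * s)) * F A ^ 2 + s / 2 := by
      refine sliceMean_mono fun A _ => ?_
      have : |F A| ^ 2 = F A ^ 2 := sq_abs _
      rw [← this]
      have h2 : 1 / (2 * s) * |F A| ^ 2 + s / 2 - |F A| = (|F A| - s) ^ 2 / (2 * s) := by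
        field_simp; ring
      have h3 : 0 ≤ (|F A| - s) ^ 2 / (2 * s) := by positivity
      linarith
    refine h₁.trans ?_
    rw [sliceMean_add, sliceMean_const_mul, sliceMean_const hk]
    have : 1 / (2 * s) * sliceMean k (fun A => F A ^ 2) ≤ 1 / (2 * s) * s ^ 2 :=
      mul_le_mul_of_nonneg_left h (by positivity)
    have e : 1 / (2 * s) * s ^ 2 = s / 2 := by field_simp
    linarith

theorem sliceMean_nonneg {F : Finset α → ℝ} (h : ∀ A, 0 ≤ F A) : 0 ≤ sliceMean k F :=
  div_nonneg (Finset.sum_nonneg fun A _ => h A) (Nat.cast_nonneg _)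

variable [DecidableEq α]

theorem sliceMean_mem (hk : k ≤ Fintype.card α) (hn : 0 < Fintype.card α) (x : α) :
    sliceMean k (fun A : Finset α => if x ∈ A then (1 : ℝ) else 0) = k / Fintype.card α := by
  have hinv : ∀ y, sliceMean k (fun A : Finset α => if y ∈ A then (1 : ℝ) else 0) =
      sliceMean k (fun A : Finset α => if x ∈ A then (1 : ℝ) else 0) := by
    intro y
    rw [← sliceMean_map (Equiv.swap x y)]
    congr 1; ext A
    simp [Finset.mem_map_equiv]
  have hsum : ∑ y, sliceMean k (fun A : Finset α => if y ∈ A then (1 : ℝ) else 0) = k := by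
    rw [← sliceMean_sum]
    refine Eq.trans (sliceMean_congr fun A hA => ?_) (sliceMean_const hk (k : ℝ))
    simp [hA]
  rw [Finset.sum_congr rfl fun y _ => hinv y] at hsum
  simp only [Finset.sum_const, nsmul_eq_mul, Finset.card_univ] at hsum
  have : (0 : ℝ) < Fintype.card α := by exact_mod_cast hn
  rw [eq_div_iff this.ne']; linarith

theorem sliceMean_sum_mem (hk : k ≤ Fintype.card α) (hn : 0 < Fintype.card α) (g : α → ℝ) :
    sliceMean k (fun A => ∑ x ∈ A, g x) = k * ((∑ x, g x) / Fintype.card α) := by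
  have : ∀ A : Finset α, ∑ x ∈ A, g x = ∑ x, g x * (if x ∈ A then (1 : ℝ) else 0) := by
    intro A; simp
  rw [show (fun A : Finset α => ∑ x ∈ A, g x) = _ from funext this, sliceMean_sum]
  simp only [sliceMean_const_mul, sliceMean_mem hk hn]
  rw [← Finset.sum_mul]; ring

/-- The second moment of a centred sum under sampling without replacement. -/
theorem sliceMean_sq_sum_le (hk : k ≤ Fintype.card α) (hn : 0 < Fintype.card α) (g : α → ℝ)
    (hg : ∑ x, g x = 0) :
    sliceMean k (fun A => (∑ x ∈ A, g x) ^ 2) ≤ k * ((∑ x, g x ^ 2) / Fintype.card α) := by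
  set P : α → α → ℝ := fun x y => sliceMean k fun A => if x ∈ A ∧ y ∈ A then (1 : ℝ) else 0
    with hP
  have hexp : sliceMean k (fun A => (∑ x ∈ A, g x) ^ 2) = ∑ x, ∑ y, g x * g y * P x y := by
    simp only [hP, ← sliceMean_const_mul, ← sliceMean_sum]
    congr 1; ext A
    rw [sq, Finset.sum_mul_sum]
    simp only [ite_and, mul_ite, mul_one, mul_zero]
    simp
  have hPmap : ∀ (σ : Equiv.Perm α) x y, P (σ x) (σ y) = P x y := by
    intro σ x y
    simp only [hP]
    rw [← sliceMean_map σ]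
    congr 1; ext A
    simp
  have hdiag : ∀ x, P x x = k / Fintype.card α := by
    intro x; simp only [hP, and_self]; exact sliceMean_mem hk hn x
  -- By symmetry all off-diagonal inclusion probabilities agree. Since `g` sums to zero, their
  -- common value `p ≥ 0` contributes only `-p * ∑ g²`.
  obtain ⟨p, hp0, hp⟩ : ∃ p : ℝ, 0 ≤ p ∧ ∀ x y, x ≠ y → P x y = p := by
    by_cases h : ∃ x y : α, x ≠ y
    · obtain ⟨x₀, y₀, h₀⟩ := h
      refine ⟨P x₀ y₀, sliceMean_nonneg fun A => by split_ifs <;> norm_num, fun x y hxy => ?_⟩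
      set σ : Equiv.Perm α := Equiv.swap x₀ x
      have hne : x ≠ σ y₀ := fun e => h₀ (σ.injective (by rw [← e]; simp [σ]))
      have := hPmap (Equiv.swap (σ y₀) y * σ) x₀ y₀
      have e : σ x₀ = x := Equiv.swap_apply_left _ _
      rw [← this, Equiv.Perm.mul_apply, Equiv.Perm.mul_apply, e,
        Equiv.swap_apply_of_ne_of_ne hne hxy, Equiv.swap_apply_left]
    · push Not at h
      exact ⟨0, le_rfl, fun x y hxy => absurd (h x y) hxy⟩
  have hval : ∀ x y, g x * g y * P x y =
      g x * (p * g y) + if x = y then (k / Fintype.card α - p) * g x ^ 2 else 0 := by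
    intro x y
    by_cases h : x = y
    · subst h; rw [hdiag]; simp; ring
    · rw [hp x y h]; simp [h]; ring
  rw [hexp]
  simp only [hval, Finset.sum_add_distrib, Finset.sum_ite_eq, Finset.mem_univ, if_true,
    ← Finset.mul_sum, hg]
  have : 0 ≤ p * ∑ x, g x ^ 2 := mul_nonneg hp0 (Finset.sum_nonneg fun _ _ => sq_nonneg _)
  have e : (k : ℝ) * ((∑ x, g x ^ 2) / Fintype.card α) =
    (k / Fintype.card α) * ∑ x, g x ^ 2 := by ring
  rw [e]
  simp
  linarith

end sliceMean

/-! ### Exponential and tail bounds for finite families. -/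

/-- The exponential inequality for the maximum of an empirical process under sampling without
replacement, with a self-normalizing penalty. -/
theorem sliceMean_exp_iSup_le {ι α : Type*} [Finite ι] [Nonempty ι] [Fintype α] [DecidableEq α]
    {k : ℕ} (hk : k ≤ Fintype.card α) (hn : 0 < Fintype.card α) (a : ι → ℝ) (q : ι → α → ℝ) :
    sliceMean k (fun A => Real.exp (((⨆ j, (a j + ∑ x ∈ A, q j x - ∑ x ∈ A, q j x ^ 2
        - k * ((∑ x, q j x ^ 2) / Fintype.card α)))
      - sliceMean k fun B => ⨆ j, (a j + ∑ x ∈ B, q j x)) / 2)) ≤ 1 := by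
  have bdd : ∀ f : ι → ℝ, BddAbove (Set.range f) := fun f => (Set.finite_range f).bddAbove
  have hp := card_slice_pos hk
  have h := sum_sum_exp_pairGap_le k a q
  have h' : sliceMean k (fun A => sliceMean k fun B => Real.exp (pairGap a q A B / 2)) ≤ 1 := by
    simp only [sliceMean, ← Finset.sum_div]
    rw [div_div, div_le_one (by positivity), ← sq]
    exact h
  refine le_trans (sliceMean_mono fun A _ => ?_) h'
  refine le_trans (Real.exp_le_exp.2 ?_) (exp_sliceMean_le hk _)
  have e : sliceMean k (fun B => pairGap a q A B / 2) =
      (sliceMean k (fun B => ⨆ j, (a j + ∑ x ∈ A, q j x -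
        (∑ x ∈ A, q j x ^ 2 + ∑ x ∈ B, q j x ^ 2))) -
        sliceMean k fun B => ⨆ j, (a j + ∑ x ∈ B, q j x)) / 2 := by
    simp only [sliceMean, pairGap, ← Finset.sum_div, Finset.sum_sub_distrib]
    ring
  rw [e]
  -- A supremum of averages over `B` is at most the average of the suprema; this replaces `∑ x ∈ B,
  -- q j x ^ 2` by its mean.
  refine div_le_div_of_nonneg_right (sub_le_sub_right (ciSup_le fun j => ?_) _) (by norm_num)
  calc _ = sliceMean k fun B => a j + ∑ x ∈ A, q j x -
        (∑ x ∈ A, q j x ^ 2 + ∑ x ∈ B, q j x ^ 2) := by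
        have := sliceMean_sum_mem hk hn fun x => q j x ^ 2
        rw [← this]
        have e₂ : (fun B : Finset α => a j + ∑ x ∈ A, q j x -
          (∑ x ∈ A, q j x ^ 2 + ∑ x ∈ B, q j x ^ 2)) = fun B : Finset α =>
          (a j + ∑ x ∈ A, q j x - ∑ x ∈ A, q j x ^ 2) + (-1) * ∑ x ∈ B, q j x ^ 2 := by
          ext B; ring
        rw [e₂, sliceMean_add, sliceMean_const hk, sliceMean_const_mul]
        ring
    _ ≤ _ := sliceMean_mono fun B _ => le_ciSup (bdd fun j => a j + ∑ x ∈ A, q j x -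
        (∑ x ∈ A, q j x ^ 2 + ∑ x ∈ B, q j x ^ 2)) j

theorem sum_eq_card_mul_avg {n k : ℕ} (hk : 0 < k) {A : Finset (Fin n)} (hA : A.card = k)
    (g : Fin n → ℝ) : ∑ i ∈ A, g i = k * TLC.avg A g := by
  have : (k : ℝ) ≠ 0 := by positivity
  rw [TLC.avg, hA]; field_simp

theorem sliceMean_sq_RuPlus_le {n k : ℕ} (hk : 0 < k) (hkn : k ≤ n) (g : Fin n → ℝ) :
    sliceMean k (fun A => TLC.RuPlus A g ^ 2) ≤ TLC.fullAvg (fun i => g i ^ 2) / k := by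
  have hn : 0 < n := hk.trans_le hkn
  have hk' : (0 : ℝ) < k := by exact_mod_cast hk
  have hn' : (0 : ℝ) < n := by exact_mod_cast hn
  set μ := TLC.fullAvg g with hμ
  have hμn : ∑ i, g i = n * μ := by rw [hμ, TLC.fullAvg]; field_simp
  have h := sliceMean_sq_sum_le (k := k) (by simpa using hkn) (by simpa using hn)
    (fun i => g i - μ) (by simp [Finset.sum_sub_distrib, hμn])
  rw [Fintype.card_fin] at h
  have e : sliceMean k (fun A => TLC.RuPlus A g ^ 2) =
      (1 / (k : ℝ) ^ 2) * sliceMean k (fun A => (∑ x ∈ A, (g x - μ)) ^ 2) := by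
    rw [← sliceMean_const_mul]
    refine sliceMean_congr fun A hA => ?_
    rw [Finset.sum_sub_distrib, sum_eq_card_mul_avg hk hA, Finset.sum_const, hA, nsmul_eq_mul,
      TLC.RuPlus, ← hμ]
    field_simp
  have h2 : ∑ x, (g x - μ) ^ 2 ≤ ∑ x, g x ^ 2 := by
    have : ∑ x, (g x - μ) ^ 2 = ∑ x, g x ^ 2 - n * μ ^ 2 := by
      have : ∀ x, (g x - μ) ^ 2 = g x ^ 2 - (2 * μ) * g x + μ ^ 2 := fun x => by ring
      simp only [this, Finset.sum_add_distrib, Finset.sum_sub_distrib, ← Finset.mul_sum, hμn,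
        Finset.sum_const, Finset.card_univ, Fintype.card_fin, nsmul_eq_mul]
      ring
    have : 0 ≤ n * μ ^ 2 := by positivity
    linarith
  rw [e]
  calc _ ≤ (1 / (k : ℝ) ^ 2) * (k * ((∑ x, g x ^ 2) / n)) := by
        refine mul_le_mul_of_nonneg_left (h.trans ?_) (by positivity)
        gcongr
    _ = _ := by rw [TLC.fullAvg]; field_simp

open Classical in
/-- A tail bound for a reweighted empirical process under sampling without replacement. -/
theorem sliceMean_exists_RuPlus_gt_le {n k : ℕ} (hk : 0 < k) (hkn : k ≤ n) {ι : Type*} [Finite ι]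
    [Nonempty ι] (h : ι → Fin n → ℝ) (w T : ι → ℝ) {H₀ l r D₁ D₂ x : ℝ}
    (hH : ∀ j i, |h j i| ≤ H₀) (hT : ∀ j, TLC.fullAvg (fun i => h j i ^ 2) ≤ T j)
    (hw₀ : ∀ j, 0 < w j) (hw₁ : ∀ j, w j ≤ 1) (hwT : ∀ j, w j * T j ≤ r)
    (hl : 0 < l) (hlH : 4 * l * H₀ ≤ 1)
    (hD₁ : sliceMean k (fun A => ⨆ j, w j * TLC.RuPlus A (h j)) ≤ D₁)
    (hD₂ : sliceMean k (fun A => ⨆ j, w j * TLC.RuPlus A (fun i => h j i ^ 2)) ≤ D₂) :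
    sliceMean k (fun A => if ∃ j, 4 * l * T j + (D₁ + 4 * l * D₂ + 4 * l * r + 2 * x / (k * l)) / w j
      < TLC.RuPlus A (h j) then (1 : ℝ) else 0) ≤ Real.exp (-x) := by
  have bdd : ∀ f : ι → ℝ, BddAbove (Set.range f) := fun f => (Set.finite_range f).bddAbove
  have hn : 0 < n := hk.trans_le hkn
  have hk' : (0 : ℝ) < k := by exact_mod_cast hk
  have hn' : (0 : ℝ) < n := by exact_mod_cast hn
  -- The quadratic term of `q` is chosen so that it dominates `q ^ 2` when `4 * l * H₀ ≤ 1`; it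
  -- cancels the random penalty over `A`.
  set q : ι → Fin n → ℝ := fun j i => w j * (l * h j i + 4 * l ^ 2 * h j i ^ 2) with hq
  set a : ι → ℝ := fun j => -(k * (w j * l * TLC.fullAvg (h j))) with ha
  have hmain := sliceMean_exp_iSup_le (k := k) (by simpa using hkn) (by simpa using hn) a q
  rw [Fintype.card_fin] at hmain
  have hqsum : ∀ (j : ι) (A : Finset (Fin n)), ∑ i ∈ A, q j i =
      w j * l * ∑ i ∈ A, h j i + 4 * l ^ 2 * w j * ∑ i ∈ A, h j i ^ 2 := by
    intro j A
    rw [Finset.mul_sum, Finset.mul_sum, ← Finset.sum_add_distrib]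
    exact Finset.sum_congr rfl fun i _ => by simp only [hq]; ring
  have hqsq : ∀ j i, q j i ^ 2 ≤ 4 * l ^ 2 * w j * h j i ^ 2 := by
    intro j i
    have h1 : |4 * l * h j i| ≤ 1 := by
      rw [abs_mul, abs_of_pos (by positivity)]
      exact (mul_le_mul_of_nonneg_left (hH j i) (by positivity)).trans hlH
    have h2 := abs_le.1 h1
    have h3 : (1 + 4 * l * h j i) ^ 2 ≤ 4 := by nlinarith
    have h4 : w j ^ 2 ≤ w j := by nlinarith [hw₀ j, hw₁ j]
    calc q j i ^ 2 = (w j ^ 2 * (1 + 4 * l * h j i) ^ 2) * (l * h j i) ^ 2 := by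
          simp only [hq]; ring
      _ ≤ (w j * 4) * (l * h j i) ^ 2 := by
          refine mul_le_mul_of_nonneg_right ?_ (sq_nonneg _)
          exact mul_le_mul h4 h3 (sq_nonneg _) (hw₀ j).le
      _ = _ := by ring
  have hqsqsum : ∀ (j : ι) (A : Finset (Fin n)),
      ∑ i ∈ A, q j i ^ 2 ≤ 4 * l ^ 2 * w j * ∑ i ∈ A, h j i ^ 2 := by
    intro j A
    rw [Finset.mul_sum]
    exact Finset.sum_le_sum fun i _ => hqsq j i
  set V : Finset (Fin n) → ℝ := fun A => ⨆ j, (a j + ∑ x ∈ A, q j x - ∑ x ∈ A, q j x ^ 2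
        - k * ((∑ x, q j x ^ 2) / n)) with hV
  set B : ℝ := sliceMean k fun B => ⨆ j, (a j + ∑ x ∈ B, q j x) with hB
  have hBle : B ≤ l * k * (D₁ + 4 * l * D₂ + 4 * l * r) := by
    have h1 : B ≤ sliceMean k fun A => l * k * (⨆ j, w j * TLC.RuPlus A (h j)) +
        (4 * l ^ 2 * k * (⨆ j, w j * TLC.RuPlus A (fun i => h j i ^ 2)) + 4 * l ^ 2 * k * r) := by
      refine sliceMean_mono fun A hA => ciSup_le fun j => ?_
      have g1 := le_ciSup (bdd fun j => w j * TLC.RuPlus A (h j)) j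
      have g2 := le_ciSup (bdd fun j => w j * TLC.RuPlus A (fun i => h j i ^ 2)) j
      have g3 : w j * TLC.fullAvg (fun i => h j i ^ 2) ≤ r :=
        (mul_le_mul_of_nonneg_left (hT j) (hw₀ j).le).trans (hwT j)
      have g1' := mul_le_mul_of_nonneg_left g1 (by positivity : 0 ≤ l * k)
      have g2' := mul_le_mul_of_nonneg_left g2 (by positivity : 0 ≤ 4 * l ^ 2 * k)
      have g3' := mul_le_mul_of_nonneg_left g3 (by positivity : 0 ≤ 4 * l ^ 2 * k)
      rw [hqsum, sum_eq_card_mul_avg hk hA, sum_eq_card_mul_avg hk hA]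
      simp only [TLC.RuPlus, ha] at g1' g2' g3' ⊢
      linarith
    rw [sliceMean_add, sliceMean_add, sliceMean_const_mul, sliceMean_const_mul,
      sliceMean_const (by simpa using hkn)] at h1
    have g1 := mul_le_mul_of_nonneg_left hD₁ (by positivity : 0 ≤ l * k)
    have g2 := mul_le_mul_of_nonneg_left hD₂ (by positivity : 0 ≤ 4 * l ^ 2 * k)
    linarith
  have hpoint : ∀ A : Finset (Fin n), A.card = k →
      (if ∃ j, 4 * l * T j + (D₁ + 4 * l * D₂ + 4 * l * r + 2 * x / (k * l)) / w j
        < TLC.RuPlus A (h j) then (1 : ℝ) else 0) ≤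
        Real.exp (-x) * Real.exp ((V A - B) / 2) := by
    intro A hA
    split_ifs with hbad
    -- Markov's inequality: on the bad event the exponent `(V A - B) / 2` is at least `x`.
    · obtain ⟨j, hj⟩ := hbad
      rw [← Real.exp_add, Real.one_le_exp_iff]
      have g1 := le_ciSup (bdd fun j => (a j + ∑ x ∈ A, q j x - ∑ x ∈ A, q j x ^ 2
        - k * ((∑ x, q j x ^ 2) / n))) j
      have g2 := hqsqsum j A
      have g3 : (∑ x, q j x ^ 2) / n ≤ 4 * l ^ 2 * w j * T j := by
        calc _ ≤ (4 * l ^ 2 * w j * ∑ i, h j i ^ 2) / n :=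
              div_le_div_of_nonneg_right (hqsqsum j Finset.univ) hn'.le
          _ = 4 * l ^ 2 * w j * TLC.fullAvg (fun i => h j i ^ 2) := by
              rw [TLC.fullAvg]; ring
          _ ≤ _ := mul_le_mul_of_nonneg_left (hT j)
              (by have := hw₀ j; positivity)
      have g3' := mul_le_mul_of_nonneg_left g3 hk'.le
      have hwj := hw₀ j
      have g4 := mul_lt_mul_of_pos_left hj (by positivity : 0 < w j * l * k)
      have g5 : w j * l * k * (4 * l * T j +
          (D₁ + 4 * l * D₂ + 4 * l * r + 2 * x / (k * l)) / w j) =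
          k * (4 * l ^ 2 * w j * T j) + l * k * (D₁ + 4 * l * D₂ + 4 * l * r) + 2 * x := by
        field_simp
        ring
      rw [g5] at g4
      change _ ≤ V A at g1
      rw [hqsum, sum_eq_card_mul_avg hk hA] at g1
      simp only [ha] at g1
      simp only [TLC.RuPlus] at g4
      linarith
    · positivity
  calc _ ≤ sliceMean k fun A => Real.exp (-x) * Real.exp ((V A - B) / 2) := sliceMean_mono hpoint
    _ = Real.exp (-x) * sliceMean k fun A => Real.exp ((V A - B) / 2) := sliceMean_const_mul _ _
    _ ≤ _ := mul_le_of_le_one_right (Real.exp_nonneg _) hmain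

/-! ### Peeling and localization. -/

/-- The supremum over a class reweighted by dyadic shells, in terms of the localized suprema. -/
theorem sliceMean_iSup_weighted_le {n k : ℕ} {J ι : Type*} [Finite ι] [Nonempty ι]
    (H : Set J) (T : J → ℝ) (φ : J → Finset (Fin n) → ℝ) {C r d₁ d₂ : ℝ}
    (hφ : ∀ h ∈ H, ∀ A : Finset (Fin n), A.card = k → |φ h A| ≤ C)
    (hd₁ : 0 ≤ d₁) (hd₂ : 0 ≤ d₂)
    (hE : ∀ p : ℕ, sliceMean k (fun A => ⨆ h : {h | h ∈ H ∧ T h ≤ 4 ^ p * r}, φ h A) ≤ 2 ^ p * d₁)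
    (hV : ∀ p : ℕ, (∃ h ∈ H, T h ≤ 4 ^ p * r) →
      ∃ h ∈ H, T h ≤ 4 ^ p * r ∧ sliceMean k (fun A => |φ h A|) ≤ 2 ^ p * d₂)
    (f : ι → J) (p : ι → ℕ) (hf : ∀ j, f j ∈ H) (hp : ∀ j, T (f j) ≤ 4 ^ p j * r) :
    sliceMean k (fun A => ⨆ j, (1 / 4 : ℝ) ^ p j * φ (f j) A) ≤ 2 * (d₁ + d₂) := by
  obtain ⟨N, hN⟩ : ∃ N, ∀ j, p j < N := by
    obtain ⟨M, hM⟩ := (Set.finite_range p).bddAbove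
    exact ⟨M + 1, fun j => Nat.lt_succ_of_le (hM ⟨j, rfl⟩)⟩
  set S : ℕ → Finset (Fin n) → ℝ := fun p A => ⨆ h : {h | h ∈ H ∧ T h ≤ 4 ^ p * r}, φ h A with hS
  have bdd : ∀ (p : ℕ) (A : Finset (Fin n)), A.card = k →
      BddAbove (Set.range fun h : {h | h ∈ H ∧ T h ≤ 4 ^ p * r} => φ h A) := by
    rintro p A hA
    refine ⟨C, ?_⟩
    rintro _ ⟨h, rfl⟩
    exact (abs_le.1 (hφ h h.2.1 A hA)).2
  -- Summing over shells needs positive parts, but the supremum may be negative. Any single member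
  -- `h` satisfies `max (S p A) 0 ≤ S p A + |φ h A|`, so one member with small mean deviation is
  -- enough.
  have hpos : ∀ p, sliceMean k (fun A => max (S p A) 0) ≤ 2 ^ p * (d₁ + d₂) := by
    intro p
    by_cases hne : ∃ h ∈ H, T h ≤ 4 ^ p * r
    · obtain ⟨h, hH, hT, hh⟩ := hV p hne
      calc _ ≤ sliceMean k fun A => S p A + |φ h A| := by
            refine sliceMean_mono fun A hA => ?_
            have g1 : φ h A ≤ S p A := le_ciSup (bdd p A hA) ⟨h, hH, hT⟩
            have g2 := neg_abs_le (φ h A)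
            have g3 := abs_nonneg (φ h A)
            exact max_le (by linarith) (by linarith)
        _ ≤ _ := by rw [sliceMean_add, mul_add]; exact add_le_add (hE p) hh
    · have : IsEmpty {h | h ∈ H ∧ T h ≤ 4 ^ p * r} := ⟨fun h => hne ⟨h, h.2⟩⟩
      have h0 : (fun A => max (S p A) 0) = fun _ => (0 : ℝ) := by
        ext A; simp only [hS, Real.iSup_of_isEmpty, max_self]
      rw [h0]
      have : sliceMean k (fun _ : Finset (Fin n) => (0 : ℝ)) = 0 := by simp [sliceMean]
      rw [this]; positivity
  calc _ ≤ sliceMean k fun A => ∑ p ∈ Finset.range N, (1 / 4 : ℝ) ^ p * max (S p A) 0 := by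
        refine sliceMean_mono fun A hA => ciSup_le fun j => ?_
        have g1 : φ (f j) A ≤ max (S (p j) A) 0 :=
          le_max_of_le_left (le_ciSup (bdd (p j) A hA) ⟨f j, hf j, hp j⟩)
        refine (mul_le_mul_of_nonneg_left g1 (by positivity)).trans ?_
        exact Finset.single_le_sum (f := fun p => (1 / 4 : ℝ) ^ p * max (S p A) 0)
          (fun p _ => mul_nonneg (by positivity) (le_max_right _ _)) (Finset.mem_range.2 (hN j))
    _ = ∑ p ∈ Finset.range N, (1 / 4 : ℝ) ^ p * sliceMean k fun A => max (S p A) 0 := by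
        rw [sliceMean_sum]; simp only [sliceMean_const_mul]
    _ ≤ ∑ p ∈ Finset.range N, (1 / 2 : ℝ) ^ p * (d₁ + d₂) := by
        refine Finset.sum_le_sum fun p _ => ?_
        calc _ ≤ (1 / 4 : ℝ) ^ p * (2 ^ p * (d₁ + d₂)) :=
              mul_le_mul_of_nonneg_left (hpos p) (by positivity)
          _ = _ := by rw [← mul_assoc, ← mul_pow]; norm_num
    _ ≤ 2 * (d₁ + d₂) := by
        rw [← Finset.sum_mul]
        refine mul_le_mul_of_nonneg_right ?_ (by positivity)
        have := sum_geometric_two_le N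
        simpa using this

/-- For `s > 0` this is monotonicity of `ψ r / √r`. For `s = 0` it says that `ψ` vanishes at `r`:
otherwise `ψ` lies above the diagonal at some `y > 0` and below it at some `z ≥ y`, and a monotone
function then has a positive fixed point, contradicting maximality of `0`. -/
theorem TLC.IsSubRoot.le_sqrt_mul {ψ : ℝ → ℝ} {s r : ℝ} (hψ : TLC.IsSubRoot ψ)
    (hs : TLC.IsFixedPointOf ψ s) (hr : 0 < r) (hsr : s ≤ r) : ψ r ≤ Real.sqrt (r * s) := by
  have hs0 : 0 ≤ s := hs.1.1
  have hss : ψ s = s := hs.1.2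
  rcases hs0.eq_or_lt with h0 | hpos
  · by_contra hcon
    rw [← h0, mul_zero, Real.sqrt_zero, not_le] at hcon
    set c := ψ r / Real.sqrt r with hc
    have hc0 : 0 < c := div_pos hcon (Real.sqrt_pos.2 hr)
    have anti : ∀ y z, 0 < y → y ≤ z → ψ z / Real.sqrt z ≤ ψ y / Real.sqrt y :=
      fun y z hy hyz => hψ.anti hy (hy.trans_le hyz) hyz
    set y := min r (c ^ 2) with hy
    set z := max r (c ^ 2) with hz
    have hy0 : 0 < y := lt_min hr (by positivity)
    have hz0 : 0 < z := lt_max_of_lt_left hr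
    have hyz : y ≤ z := min_le_max
    have hψy : y ≤ ψ y := by
      have h1 := anti y r hy0 (min_le_left _ _)
      rw [← hc, le_div_iff₀ (Real.sqrt_pos.2 hy0)] at h1
      have h2 : Real.sqrt y ≤ c := by
        rw [Real.sqrt_le_left hc0.le]; exact min_le_right _ _
      nlinarith [Real.mul_self_sqrt hy0.le, Real.sqrt_nonneg y]
    have hψz : ψ z ≤ z := by
      have h1 := anti r z hr (le_max_left _ _)
      rw [← hc, div_le_iff₀ (Real.sqrt_pos.2 hz0)] at h1
      have h2 : c ≤ Real.sqrt z := Real.le_sqrt_of_sq_le (le_max_right _ _)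
      nlinarith [Real.mul_self_sqrt hz0.le, Real.sqrt_nonneg z]
    set E := {t : ℝ | t ∈ Set.Icc y z ∧ t ≤ ψ t} with hE
    have hyE : y ∈ E := ⟨⟨le_rfl, hyz⟩, hψy⟩
    have hEb : BddAbove E := ⟨z, fun t ht => ht.1.2⟩
    have hy_le : y ≤ sSup E := le_csSup hEb hyE
    have hle_z : sSup E ≤ z := csSup_le ⟨y, hyE⟩ fun t ht => ht.1.2
    have hsup0 : 0 ≤ sSup E := hy0.le.trans hy_le
    have h1 : sSup E ≤ ψ (sSup E) := csSup_le ⟨y, hyE⟩ fun t ht =>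
      ht.2.trans (hψ.mono (hy0.le.trans ht.1.1) hsup0 (le_csSup hEb ht))
    have h2 : ψ (sSup E) ∈ E := ⟨⟨hy_le.trans h1, (hψ.mono hsup0 hz0.le hle_z).trans hψz⟩,
      hψ.mono hsup0 (hsup0.trans h1) h1⟩
    have h3 : ψ (sSup E) = sSup E := le_antisymm (le_csSup hEb h2) h1
    have h4 := hs.2 ⟨hsup0, h3⟩
    linarith
  · have h1 : ψ r / Real.sqrt r ≤ ψ s / Real.sqrt s := hψ.anti hpos hr hsr
    rw [hss, div_le_iff₀ (Real.sqrt_pos.2 hr), Real.div_sqrt, mul_comm] at h1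
    rwa [Real.sqrt_mul hr.le]

theorem abs_avg_le {n : ℕ} {A : Finset (Fin n)} {g : Fin n → ℝ} {C : ℝ} (hC : 0 ≤ C)
    (hg : ∀ i, |g i| ≤ C) : |TLC.avg A g| ≤ C := by
  rw [TLC.avg, abs_div, Nat.abs_cast]
  refine div_le_of_le_mul₀ (Nat.cast_nonneg _) hC ((Finset.abs_sum_le_sum_abs _ _).trans ?_)
  refine (Finset.sum_le_sum fun i _ => hg i).trans ?_
  simp [mul_comm]

theorem fullAvg_eq_avg_univ {n : ℕ} (g : Fin n → ℝ) : TLC.fullAvg g = TLC.avg Finset.univ g := by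
  simp [TLC.fullAvg, TLC.avg]

theorem abs_RuPlus_le {n : ℕ} {A : Finset (Fin n)} {g : Fin n → ℝ} {C : ℝ} (hC : 0 ≤ C)
    (hg : ∀ i, |g i| ≤ C) : |TLC.RuPlus A g| ≤ 2 * C := by
  have h₁ := abs_avg_le (A := A) hC hg
  have h₂ := abs_avg_le (A := Finset.univ) hC hg
  rw [TLC.RuPlus, fullAvg_eq_avg_univ]
  refine (abs_sub _ _).trans ?_
  linarith

/-- The least admissible `p` is either `0` or has `4 ^ (p - 1) * r < T`. The second bound controls
the cost of undoing the weight. -/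
theorem exists_shell {T r : ℝ} (hT : 0 ≤ T) (hr : 0 < r) :
    ∃ p : ℕ, T ≤ 4 ^ p * r ∧ (4 : ℝ) ^ p ≤ 1 + 4 * T / r := by
  have hex : ∃ p : ℕ, T ≤ 4 ^ p * r := by
    obtain ⟨p, hp⟩ := pow_unbounded_of_one_lt (T / r) (by norm_num : (1 : ℝ) < 4)
    exact ⟨p, ((div_lt_iff₀ hr).1 hp).le⟩
  classical
  refine ⟨Nat.find hex, Nat.find_spec hex, ?_⟩
  have h0 : 0 ≤ 4 * T / r := by positivity
  rcases Nat.eq_zero_or_pos (Nat.find hex) with h | h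
  · rw [h]; linarith
  · obtain ⟨p, hp⟩ := Nat.exists_eq_succ_of_ne_zero h.ne'
    have hmin := Nat.find_min hex (m := p) (by omega)
    rw [hp, pow_succ]
    have : (4 : ℝ) ^ p * 4 ≤ 4 * T / r := by
      rw [le_div_iff₀ hr]; linarith
    linarith

theorem fullAvg_sq_sq_le {n : ℕ} {g : Fin n → ℝ} {H₀ : ℝ} (hg : ∀ i, |g i| ≤ H₀) :
    TLC.fullAvg (fun i => (g i ^ 2) ^ 2) ≤ H₀ ^ 2 * TLC.fullAvg (fun i => g i ^ 2) := by
  rw [TLC.fullAvg, TLC.fullAvg, ← mul_div_assoc, Finset.mul_sum]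
  refine div_le_div_of_nonneg_right (Finset.sum_le_sum fun i _ => ?_) (Nat.cast_nonneg _)
  have h : g i ^ 2 ≤ H₀ ^ 2 := sq_le_sq' (by linarith [abs_le.1 (hg i)]) (abs_le.1 (hg i)).2
  nlinarith [sq_nonneg (g i)]

open Classical in
/-- Localized one-sided deviation bound under sampling without replacement. -/
theorem sliceMean_exists_RuPlus_gt_localized_le {n k : ℕ} (hk : 0 < k) (hkn : k ≤ n) {Z : Type*}
    (H : Set (Z → ℝ)) (q : (Z → ℝ) → Fin n → ℝ) (T : (Z → ℝ) → ℝ) {H₀ P s ρ x : ℝ} {ψ : ℝ → ℝ}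
    (hH₀ : 0 < H₀) (hP : 256 < P) (hq : ∀ h ∈ H, ∀ i, |q h i| ≤ H₀)
    (hT : ∀ h ∈ H, TLC.fullAvg (fun i => q h i ^ 2) ≤ T h)
    (hψ : TLC.IsSubRoot ψ) (hs : TLC.IsFixedPointOf ψ s) (hsρ : s ≤ ρ)
    (h₁ : ∀ r, s ≤ r →
      sliceMean k (fun A => ⨆ h : TLC.localized H T r, TLC.RuPlus A (q h)) ≤ ψ r)
    (h₂ : ∀ r, s ≤ r →
      sliceMean k (fun A => ⨆ h : TLC.localized H T r, TLC.RuPlus A (fun i => q h i ^ 2)) ≤ ψ r)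
    (hx : 0 < x) (hx₁ : 1 ≤ x ∨ ∃ h₀ ∈ H, (∀ i, q h₀ i = 0) ∧ T h₀ ≤ ρ) :
    sliceMean k (fun A => if ∃ h ∈ H,
      64 * (T h + (P ^ 2 * ρ + P ^ 2 * (1 + H₀) ^ 2 * (x / k))) / P < TLC.RuPlus A (q h)
      then (1 : ℝ) else 0) ≤ Real.exp (-x) := by
  have hk' : (0 : ℝ) < k := by exact_mod_cast hk
  have hP0 : 0 < P := by linarith
  have hs0 : 0 ≤ s := hs.1.1
  have hρ : 0 ≤ ρ := hs0.trans hsρ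
  rcases H.eq_empty_or_nonempty with rfl | ⟨hdef, hdefH⟩
  · simp [sliceMean, Real.exp_nonneg]
  have hT0 : ∀ h ∈ H, 0 ≤ T h := fun h hh => le_trans
    (div_nonneg (Finset.sum_nonneg fun _ _ => sq_nonneg _) (Nat.cast_nonneg _)) (hT h hh)
  set r := P ^ 2 * ρ + P ^ 2 * (1 + H₀) ^ 2 * (x / k) with hr
  have hxk : 0 < x / k := by positivity
  have hr0 : 0 < r := by positivity
  have hρr : P ^ 2 * ρ ≤ r := by
    rw [hr]; have : 0 ≤ P ^ 2 * (1 + H₀) ^ 2 * (x / k) := by positivity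
    linarith
  have hxr : P ^ 2 * (1 + H₀) ^ 2 * (x / k) ≤ r := by
    rw [hr]; have : 0 ≤ P ^ 2 * ρ := by positivity
    linarith
  have hρr' : ρ ≤ r := le_trans (le_mul_of_one_le_left hρ (one_le_pow₀ (by linarith))) hρr
  have h4 : ∀ p : ℕ, r ≤ 4 ^ p * r := fun p =>
    le_mul_of_one_le_left hr0.le (one_le_pow₀ (by norm_num))
  have h42 : ∀ p : ℕ, (4 : ℝ) ^ p = (2 ^ p) ^ 2 := fun p => by
    rw [← pow_mul, mul_comm, pow_mul]; norm_num
  set d := r / P with hd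
  have hd0 : 0 < d := by positivity
  have hψd : ∀ p : ℕ, ψ (4 ^ p * r) ≤ 2 ^ p * d := by
    intro p
    refine (hψ.le_sqrt_mul hs (by positivity) ((hsρ.trans hρr').trans (h4 p))).trans ?_
    refine Real.sqrt_le_iff.2 ⟨by positivity, ?_⟩
    rw [h42, hd]
    have : P ^ 2 * s ≤ r := (mul_le_mul_of_nonneg_left hsρ (by positivity)).trans hρr
    have h3 : s ≤ r / P ^ 2 := by rw [le_div_iff₀ (by positivity)]; linarith
    calc (2 ^ p) ^ 2 * r * s ≤ (2 ^ p) ^ 2 * r * (r / P ^ 2) :=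
          mul_le_mul_of_nonneg_left h3 (by positivity)
      _ = _ := by field_simp
  -- The only use of `1 ≤ x`: it bounds the variance factor `1 / k` by `x / k`, which is part of
  -- `r`. A function vanishing on the sample has no deviation and makes this unnecessary.
  have hsec : ∀ (p : ℕ) (g : Fin n → ℝ), 1 ≤ x →
      TLC.fullAvg (fun i => g i ^ 2) ≤ (1 + H₀) ^ 2 * (4 ^ p * r) →
      sliceMean k (fun A => |TLC.RuPlus A g|) ≤ 2 ^ p * d := by
    intro p g hx1 hg
    refine sliceMean_abs_le (by simpa using hkn) (by positivity) ?_
    refine (sliceMean_sq_RuPlus_le hk hkn g).trans ?_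
    have h5 : 1 / (k : ℝ) ≤ x / k := div_le_div_of_nonneg_right hx1 hk'.le
    have h6 : (1 + H₀) ^ 2 * (1 / (k : ℝ)) ≤ r / P ^ 2 := by
      rw [le_div_iff₀ (by positivity)]
      have := mul_le_mul_of_nonneg_left h5 (by positivity : 0 ≤ P ^ 2 * (1 + H₀) ^ 2)
      linarith
    calc _ ≤ (1 + H₀) ^ 2 * (4 ^ p * r) / k := div_le_div_of_nonneg_right hg hk'.le
      _ = 4 ^ p * r * ((1 + H₀) ^ 2 * (1 / (k : ℝ))) := by ring
      _ ≤ 4 ^ p * r * (r / P ^ 2) := mul_le_mul_of_nonneg_left h6 (by positivity)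
      _ = _ := by rw [h42, hd]; field_simp
  have hzero : sliceMean k (fun A : Finset (Fin n) => |TLC.RuPlus A fun _ => (0 : ℝ)|) = 0 := by
    simp [TLC.RuPlus, TLC.avg, TLC.fullAvg, sliceMean]
  have hV₁ : ∀ p : ℕ, (∃ h ∈ H, T h ≤ 4 ^ p * r) → ∃ h ∈ H, T h ≤ 4 ^ p * r ∧
      sliceMean k (fun A => |TLC.RuPlus A (q h)|) ≤ 2 ^ p * d := by
    rintro p ⟨h, hh, hTh⟩
    rcases hx₁ with hx1 | ⟨h₀, hh₀, hz, hTh₀⟩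
    · refine ⟨h, hh, hTh, hsec p _ hx1 (((hT h hh).trans hTh).trans ?_)⟩
      exact le_mul_of_one_le_left (by positivity) (by nlinarith)
    · refine ⟨h₀, hh₀, (hTh₀.trans hρr').trans (h4 p), ?_⟩
      rw [show q h₀ = fun _ => 0 from funext hz, hzero]
      positivity
  have hV₂ : ∀ p : ℕ, (∃ h ∈ H, T h ≤ 4 ^ p * r) → ∃ h ∈ H, T h ≤ 4 ^ p * r ∧
      sliceMean k (fun A => |TLC.RuPlus A (fun i => q h i ^ 2)|) ≤ 2 ^ p * d := by
    rintro p ⟨h, hh, hTh⟩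
    rcases hx₁ with hx1 | ⟨h₀, hh₀, hz, hTh₀⟩
    · refine ⟨h, hh, hTh, hsec p _ hx1 ((fullAvg_sq_sq_le (hq h hh)).trans ?_)⟩
      have h7 : TLC.fullAvg (fun i => q h i ^ 2) ≤ 4 ^ p * r := (hT h hh).trans hTh
      refine (mul_le_mul_of_nonneg_left h7 (sq_nonneg _)).trans ?_
      exact mul_le_mul_of_nonneg_right (by nlinarith) (by positivity)
    · refine ⟨h₀, hh₀, (hTh₀.trans hρr').trans (h4 p), ?_⟩
      rw [show (fun i => q h₀ i ^ 2) = fun _ => (0 : ℝ) from funext fun i => by rw [hz i]; simp,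
        hzero]
      positivity
  let bad : Finset (Fin n) → (Z → ℝ) → Prop := fun A h => 64 * (T h + r) / P < TLC.RuPlus A (q h)
  -- Reduction to a finite family: one offending function is chosen for each of the finitely many
  -- index sets, so the sets themselves index the family.
  have hsel : ∀ A : Finset (Fin n), ∃ h ∈ H, (∃ h' ∈ H, bad A h') → bad A h := by
    intro A
    by_cases hA : ∃ h' ∈ H, bad A h'
    · obtain ⟨h', hh', hb⟩ := hA
      exact ⟨h', hh', fun _ => hb⟩
    · exact ⟨hdef, hdefH, fun h => absurd h hA⟩
  choose f hfH hf using hsel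
  choose p hp hp' using fun A => exists_shell (hT0 (f A) (hfH A)) hr0
  have hD₁ := sliceMean_iSup_weighted_le (k := k) H T (fun h A => TLC.RuPlus A (q h))
    (C := 2 * H₀) (fun h hh A _ => abs_RuPlus_le hH₀.le (hq h hh)) hd0.le hd0.le
    (fun p => (h₁ _ ((hsρ.trans hρr').trans (h4 p))).trans (hψd p)) hV₁ f p hfH hp
  have hD₂ := sliceMean_iSup_weighted_le (k := k) H T (fun h A => TLC.RuPlus A (fun i => q h i ^ 2))
    (C := 2 * H₀ ^ 2) (fun h hh A _ => abs_RuPlus_le (sq_nonneg _) fun i => by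
      rw [abs_pow]; exact pow_le_pow_left₀ (abs_nonneg _) (hq h hh i) 2) hd0.le hd0.le
    (fun p => (h₂ _ ((hsρ.trans hρr').trans (h4 p))).trans (hψd p)) hV₂ f p hfH hp
  -- Small enough for `4 * l * H₀ ≤ 1` and for slope `4 * l ≤ 2 / P` in `T`, yet large enough that
  -- `2 * x / (k * l) ≤ 4 * d`.
  set l := 1 / (2 * P * (1 + H₀)) with hl
  have hl0 : 0 < l := by positivity
  have hlP : l * P ≤ 1 / 2 := by
    have : l * P = 1 / (2 * (1 + H₀)) := by rw [hl]; field_simp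
    rw [this]
    exact one_div_le_one_div_of_le (by norm_num) (by linarith)
  have hlH : 4 * l * H₀ ≤ 1 := by
    have : 4 * l * H₀ = 2 * H₀ / (P * (1 + H₀)) := by rw [hl]; field_simp; norm_num
    rw [this, div_le_one (by positivity)]
    nlinarith
  have hmain := sliceMean_exists_RuPlus_gt_le hk hkn (fun A => q (f A))
    (fun A => (1 / 4 : ℝ) ^ p A) (fun A => T (f A)) (x := x) (r := r) (fun A => hq _ (hfH A))
    (fun A => hT _ (hfH A)) (fun A => by positivity)
    (fun A => pow_le_one₀ (by norm_num) (by norm_num))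
    (fun A => by
      have := mul_le_mul_of_nonneg_left (hp A) (by positivity : (0 : ℝ) ≤ (1 / 4) ^ p A)
      rwa [← mul_assoc, ← mul_pow, show (1 / 4 * 4 : ℝ) = 1 by norm_num, one_pow, one_mul] at this)
    hl0 hlH hD₁ hD₂
  refine le_trans (sliceMean_mono fun A _ => ?_) hmain
  split_ifs with hb hc
  · exact le_rfl
  · refine absurd ⟨A, lt_of_le_of_lt ?_ (hf A hb)⟩ hc
    have hTf := hT0 (f A) (hfH A)
    -- The four terms contribute at most `4 d`, `4 d`, `2 d` and `4 d`. After division by the weight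
    -- the total is at most `14 r / P + 58 T / P`, within the factor `64`.
    have hQ : 2 * (d + d) + 4 * l * (2 * (d + d)) + 4 * l * r + 2 * x / (k * l) ≤ 14 * d := by
      have a1 : l * d ≤ d / 4 := by nlinarith
      have a2 : l * r ≤ d / 2 := by
        have : r = P * d := by rw [hd]; field_simp
        rw [this]; nlinarith
      have a3 : 2 * x / (k * l) ≤ 4 * d := by
        have e1 : 2 * x / (k * l) = 4 * (P * (1 + H₀) * (x / k)) := by
          rw [hl]; field_simp; norm_num
        have e2 : P * (1 + H₀) * (x / k) ≤ d := by
          rw [hd, le_div_iff₀ hP0]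
          refine le_trans ?_ hxr
          have : 1 + H₀ ≤ (1 + H₀) ^ 2 := by nlinarith
          have := mul_le_mul_of_nonneg_left this (by positivity : 0 ≤ P ^ 2 * (x / k))
          linarith
        linarith
      linarith
    have hQ0 : 0 ≤ 2 * (d + d) + 4 * l * (2 * (d + d)) + 4 * l * r + 2 * x / (k * l) := by
      positivity
    have hdiv : (2 * (d + d) + 4 * l * (2 * (d + d)) + 4 * l * r + 2 * x / (k * l)) /
        (1 / 4 : ℝ) ^ p A ≤ 14 * d * (1 + 4 * T (f A) / r) := by
      rw [one_div, inv_pow, div_inv_eq_mul]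
      exact mul_le_mul hQ (hp' A) (by positivity) (by positivity)
    have e : 14 * d * (1 + 4 * T (f A) / r) = 14 * r / P + 56 * (T (f A) / P) := by
      rw [hd]; field_simp; ring
    have e4 : 4 * l * T (f A) ≤ 2 * (T (f A) / P) := by
      have : l ≤ 1 / 2 / P := by rw [le_div_iff₀ hP0]; exact hlP
      calc _ ≤ 4 * (1 / 2 / P) * T (f A) := by gcongr
        _ = _ := by ring
    have e5 : 64 * (T (f A) + r) / P = 64 * (T (f A) / P) + 64 * (r / P) := by ring
    have e6 : 0 ≤ T (f A) / P := by positivity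
    have e7 : 14 * r / P = 14 * (r / P) := by ring
    have e8 : 0 ≤ r / P := by positivity
    rw [e5]
    linarith
  · exact zero_le_one
  · exact le_rfl

/-! ### From deviations of the smaller sample to the train–test gap. -/

theorem sliceMean_compl {m u : ℕ} (F : Finset (Fin (m + u)) → ℝ) :
    sliceMean u (fun A => F Aᶜ) = sliceMean m F := by
  have hc : (Finset.powersetCard u (Finset.univ : Finset (Fin (m + u)))).card =
      (Finset.powersetCard m (Finset.univ : Finset (Fin (m + u)))).card := by
    simp only [Finset.card_powersetCard, Finset.card_univ, Fintype.card_fin]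
    exact (Nat.choose_symm_add).symm
  rw [sliceMean, sliceMean, hc]
  congr 1
  refine Finset.sum_bij' (fun A _ => Aᶜ) (fun A _ => Aᶜ) ?_ ?_ ?_ ?_ ?_
  · intro A hA
    have := (Finset.mem_powersetCard.1 hA).2
    simp [Finset.card_compl, this]
  · intro A hA
    have := (Finset.mem_powersetCard.1 hA).2
    simp [Finset.card_compl, this]
  · intro A _; simp
  · intro A _; simp
  · intro A _; rfl

open Classical in
theorem one_sub_le_prob {m u : ℕ} {E bad : Finset (Fin (m + u)) → Prop} {ε : ℝ}
    (hbad : sliceMean u (fun A => if bad A then (1 : ℝ) else 0) ≤ ε)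
    (hE : ∀ A : Finset (Fin (m + u)), A.card = u → ¬ bad A → E A) :
    1 - ε ≤ TLC.prob m u E := by
  have hu : u ≤ Fintype.card (Fin (m + u)) := by simp
  have e : TLC.prob m u E = sliceMean u (fun A => if E A then (1 : ℝ) else 0) := by
    simp [TLC.prob, TLC.testSets, sliceMean]
  have h : (1 : ℝ) ≤ sliceMean u (fun A : Finset (Fin (m + u)) =>
      (if E A then (1 : ℝ) else 0) + if bad A then (1 : ℝ) else 0) := by
    refine (sliceMean_const hu (1 : ℝ)).ge.trans (sliceMean_mono fun A hA => ?_)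
    by_cases hb : bad A
    · simp only [hb, if_true]; split_ifs <;> norm_num
    · simp [hb, hE A hA hb]
  rw [sliceMean_add] at h
  rw [e]; linarith

theorem mul_RuPlus_eq {m u : ℕ} (hm : 0 < m) (hu : 0 < u) {A : Finset (Fin (m + u))}
    (hA : A.card = u) (g : Fin (m + u) → ℝ) :
    ((m : ℝ) + u) * TLC.RuPlus A g = m * (TLC.avg A g - TLC.avg Aᶜ g) ∧
      ((m : ℝ) + u) * TLC.RuPlus Aᶜ g = u * (TLC.avg Aᶜ g - TLC.avg A g) := by
  have hAc : Aᶜ.card = m := by simp [Finset.card_compl, hA]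
  have h₁ := sum_eq_card_mul_avg hu hA g
  have h₂ := sum_eq_card_mul_avg hm hAc g
  have h₃ := Finset.sum_add_sum_compl A g
  have hpos : (0 : ℝ) < (m : ℝ) + u := by positivity
  have h₄ : ((m : ℝ) + u) * TLC.fullAvg g = u * TLC.avg A g + m * TLC.avg Aᶜ g := by
    rw [← h₁, ← h₂, h₃, TLC.fullAvg]; push_cast; field_simp
  constructor <;> (rw [TLC.RuPlus, mul_sub, h₄]; ring)

theorem mainTheorem3 (K : ℝ) (hK : 1 < K) :
    ∃ c₀ : ℝ, 0 < c₀ ∧ ∀ H₀ : ℝ, 0 < H₀ → ∃ c₁ : ℝ, 0 < c₁ ∧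
      ∀ (m u : ℕ), 0 < m → 0 < u →
      ∀ (Z : Type*) (z : Fin (m + u) → Z) (H : Set (Z → ℝ)),
        (∀ h ∈ H, ∀ i, |h (z i)| ≤ H₀) →
      ∀ (T : (Z → ℝ) → ℝ), (∀ h ∈ H, TLC.Tn z h ≤ T h) →
      ∀ (ψu ψm : ℝ → ℝ) (ru rm : ℝ),
        TLC.IsSubRoot ψu → TLC.IsFixedPointOf ψu ru →
        TLC.IsSubRoot ψm → TLC.IsFixedPointOf ψm rm →
        (∀ r, ru ≤ r →
          max
            (TLC.expect m u fun A =>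
              ⨆ h : TLC.localized H T r, TLC.RuPlus A (TLC.onSample z h))
            (TLC.expect m u fun A =>
              ⨆ h : TLC.localized H T r, TLC.RuPlus A (TLC.onSampleSq z h))
          ≤ ψu r) →
        (∀ r, rm ≤ r →
          max
            (TLC.expect m u fun A =>
              ⨆ h : TLC.localized H T r, TLC.RmMinus A (TLC.onSample z h))
            (TLC.expect m u fun A =>
              ⨆ h : TLC.localized H T r, TLC.RmPlus A (TLC.onSampleSq z h))
          ≤ ψm r) →
      ∀ x : ℝ, 0 < x →
        (1 ≤ x ∨ ∃ h₀ ∈ H, (∀ i, h₀ (z i) = 0) ∧ T h₀ ≤ max ru rm) →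
        1 - Real.exp (-x) ≤
          TLC.prob m u (fun A => ∀ h ∈ H,
            TLC.avg A (TLC.onSample z h) ≤
              TLC.avg Aᶜ (TLC.onSample z h) + T h / K + c₀ * (ru + rm)
                + c₁ * x / (min m u : ℕ)) := by
  have hK0 : 0 < K := by linarith
  -- With `P = 256 * K` and the factor `2` from passing to the gap, the coefficient of `T h` is `128
  -- / P = 1 / (2 * K)`, and the other constants are `128 * P = 32768 * K`.
  refine ⟨32768 * K, by positivity, fun H₀ hH₀ => ⟨32768 * K * (1 + H₀) ^ 2, by positivity, ?_⟩⟩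
  intro m u hm hu Z z H hH T hT ψu ψm ru rm hψu hru hψm hrm hu' hm' x hx hx₁
  have hm0 : (0 : ℝ) < m := by exact_mod_cast hm
  have hu0 : (0 : ℝ) < u := by exact_mod_cast hu
  have hru0 : 0 ≤ ru := hru.1.1
  have hrm0 : 0 ≤ rm := hrm.1.1
  have hmax : max ru rm ≤ ru + rm := max_le (by linarith) (by linarith)
  have hP : 256 < 256 * K := by linarith
  have hT0 : ∀ h ∈ H, 0 ≤ T h := fun h hh => le_trans
    (div_nonneg (Finset.sum_nonneg fun _ _ => sq_nonneg _) (Nat.cast_nonneg _)) (hT h hh)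
  have hbound : ∀ (k : ℕ), 0 < k → ∀ h ∈ H,
      2 * (64 * (T h + ((256 * K) ^ 2 * (ru + rm) + (256 * K) ^ 2 * (1 + H₀) ^ 2 * (x / k))) /
        (256 * K)) ≤ T h / K + 32768 * K * (ru + rm) + 32768 * K * (1 + H₀) ^ 2 * x / k := by
    intro k hk h hh
    have hk0 : (0 : ℝ) < k := by exact_mod_cast hk
    have e : 2 * (64 * (T h + ((256 * K) ^ 2 * (ru + rm) +
        (256 * K) ^ 2 * (1 + H₀) ^ 2 * (x / k))) / (256 * K)) =
        (T h / K) / 2 + 32768 * K * (ru + rm) + 32768 * K * (1 + H₀) ^ 2 * x / k := by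
      field_simp; ring
    have : 0 ≤ T h / K := div_nonneg (hT0 h hh) hK0.le
    rw [e]; linarith
  have hnonneg : ∀ (k : ℕ), ∀ h ∈ H,
      0 ≤ 64 * (T h + ((256 * K) ^ 2 * (ru + rm) + (256 * K) ^ 2 * (1 + H₀) ^ 2 * (x / k))) /
        (256 * K) := by
    intro k h hh
    have := hT0 h hh
    positivity
  rcases le_total u m with hum | hmu
  · rw [min_eq_right hum]
    have hum' : (u : ℝ) ≤ m := by exact_mod_cast hum
    have hmain := sliceMean_exists_RuPlus_gt_localized_le (ρ := ru + rm) (x := x) hu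
      (Nat.le_add_left u m) H (TLC.onSample z) T hH₀ hP hH hT hψu hru (by linarith)
      (fun r hr => (le_max_left _ _).trans (hu' r hr))
      (fun r hr => (le_max_right _ _).trans (hu' r hr)) hx
      (hx₁.imp_right fun ⟨h₀, hh₀, hz, hTh⟩ => ⟨h₀, hh₀, hz, hTh.trans hmax⟩)
    refine one_sub_le_prob hmain fun A hA hgood h hh => ?_
    push Not at hgood
    have h₁ := hgood h hh
    have h₂ := (mul_RuPlus_eq hm hu hA (TLC.onSample z h)).1
    have h₃ := hbound u hu h hh
    have h₄ := hnonneg u h hh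
    set Y := 64 * (T h + ((256 * K) ^ 2 * (ru + rm) + (256 * K) ^ 2 * (1 + H₀) ^ 2 * (x / u))) /
        (256 * K)
    -- The gap is `(m + u) / m` times the test deviation, and `m + u ≤ 2 * m` because `u ≤ m`.
    have h₅ : (m : ℝ) * (TLC.avg A (TLC.onSample z h) - TLC.avg Aᶜ (TLC.onSample z h)) ≤
        m * (2 * Y) := by
      rw [← h₂]
      have := mul_le_mul_of_nonneg_left h₁ (by positivity : (0 : ℝ) ≤ (m : ℝ) + u)
      nlinarith
    have h₆ := le_of_mul_le_mul_left h₅ hm0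
    linarith
  · rw [min_eq_left hmu]
    have hmu' : (m : ℝ) ≤ u := by exact_mod_cast hmu
    have hneg : ∀ (A : Finset (Fin (m + u))) (g : Fin (m + u) → ℝ),
        TLC.RuPlus A (fun i => -g i) = -TLC.RuPlus A g := by
      intro A g
      simp only [TLC.RuPlus, TLC.avg, TLC.fullAvg, Finset.sum_neg_distrib]; ring
    have hmain := sliceMean_exists_RuPlus_gt_localized_le (ρ := ru + rm) (x := x) hm
      (Nat.le_add_right m u) H (fun h i => -TLC.onSample z h i) T hH₀ hP
      (fun h hh i => by rw [abs_neg]; exact hH h hh i)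
      (fun h hh => by simp only [neg_sq]; exact hT h hh) hψm hrm (by linarith)
      (fun r hr => by
        refine le_trans (le_of_eq ?_) ((le_max_left _ _).trans (hm' r hr))
        rw [← sliceMean_compl]
        simp only [hneg]
        rfl)
      (fun r hr => by
        refine le_trans (le_of_eq ?_) ((le_max_right _ _).trans (hm' r hr))
        rw [← sliceMean_compl]
        simp only [neg_sq]
        rfl) hx
      (hx₁.imp_right fun ⟨h₀, hh₀, hz, hTh⟩ =>
        ⟨h₀, hh₀, fun i => neg_eq_zero.2 (hz i), hTh.trans hmax⟩)
    -- The bound was obtained for a uniform training set of size `m`; complementation restates it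
    -- for the test set.
    rw [← sliceMean_compl] at hmain
    refine one_sub_le_prob hmain fun A hA hgood h hh => ?_
    push Not at hgood
    have h₁ := hgood h hh
    rw [hneg] at h₁
    have h₂ := (mul_RuPlus_eq hm hu hA (TLC.onSample z h)).2
    have h₃ := hbound m hm h hh
    have h₄ := hnonneg m h hh
    set Y := 64 * (T h + ((256 * K) ^ 2 * (ru + rm) + (256 * K) ^ 2 * (1 + H₀) ^ 2 * (x / m))) /
        (256 * K)
    have h₅ : (u : ℝ) * (TLC.avg A (TLC.onSample z h) - TLC.avg Aᶜ (TLC.onSample z h)) ≤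
        u * (2 * Y) := by
      have := mul_le_mul_of_nonneg_left h₁ (by positivity : (0 : ℝ) ≤ (m : ℝ) + u)
      nlinarith
    have h₆ := le_of_mul_le_mul_left h₅ hu0
    linarith
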